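/- Let $V$ be the ground model. Let $\mathbb P$ be a notion of forcing that is nontrivial, i.e. every condition in $\mathbb P$ has two incompatible extensions, and let $\dot{\mathbb Q}$ be a $\mathbb P$-name for a notion of forcing (a preordered set). Let $\beta$ and $\theta$ be ordinals such that $|\mathbb P|\le\beta$, $\Vdash_{\mathbb P}$ "$\dot{\mathbb Q}$ is ${\le}\beta$-strategically closed", and $\operatorname{cof}(\theta)>\beta$ (both computed in $V$). Then the two-step iteration $\mathbb P*\dot{\mathbb Q}$ adds no fresh $\theta$-sequences, i.e. every condition of $\mathbb P*\dot{\mathbb Q}$ forces that there are none. Here a sequence in a forcing extension of $V$ is *fresh* when it is not in $V$ but all of its proper initial segments are; a $\theta$-sequence is a function with domain $\theta$, with arbitrary sets as values. A notion of forcing $\mathbb Q$ is *${\le}\beta$-strategically closed* when the second player has a winning strategy in the game in which two players alternately play conditions to build a descending sequence $\langle q_\alpha\mid\alpha\le\beta\rangle$ in $\mathbb Q$; the first player makes the first move $q_0$, the second player moves at limit stages, each move has to be below all the earlier ones, and the second player wins when she never fails to have a legal move at her stages $\alpha\le\beta$. -/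

import Mathlib

universe u

namespace Forcing

/-! ### Names

The ground model `V` is the universe of sets `PSet.{u}`; a notion of forcing is a preorder
`P : Type u`, where `q ≤ p` means that `q` is stronger than `p`. -/

/-- `P`-names: `mk ι name cond` is the name `{(name i, cond i) : i ∈ ι}`. -/
inductive PName (P : Type u) : Type (u + 1)
  | mk (ι : Type u) (name : ι → PName P) (cond : ι → P) : PName P

namespace PName

variable {P : Type u}

/-- The index type of a name; `x.elem i` for `i : x.Index` are the members of `dom x`. -/
def Index : PName P → Type u
  | mk ι _ _ => ι

/-- The members of the domain of a name. -/
def elem : (x : PName P) → x.Index → PName P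
  | mk _ name _ => name

/-- The canonical name `ǎ = {(b̌, p) : b ∈ a, p ∈ P}` of a set `a` of the ground model. -/
def check (P : Type u) : PSet.{u} → PName P
  | ⟨α, A⟩ => mk (α × P) (fun i => check P (A i.1)) (fun i => i.2)

/-- The canonical name of an ordinal. -/
noncomputable def ord (P : Type u) (α : Ordinal.{u}) : PName P :=
  check P α.toPSet

/-- The canonical name of the unordered pair `{x, y}`. -/
def upair (x y : PName P) : PName P :=
  mk (Bool × P) (fun i => cond i.1 x y) (fun i => i.2)

/-- The canonical name of the (Kuratowski) ordered pair `(x, y) = {{x, x}, {x, y}}`. -/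
def opair (x y : PName P) : PName P :=
  upair (upair x x) (upair x y)

end PName

/-! ### The forcing relation -/

/-- A sentence of the forcing language, identified with the set of conditions forcing it:
`φ p` means `p ⊩ φ`.  The clauses below define the forcing relation by recursion. -/
abbrev Sentence (P : Type u) : Type u := P → Prop

section Relation

variable {P : Type u} [Preorder P]

/-- `⊩ φ`: every condition forces `φ`. -/
def Forced (φ : Sentence P) : Prop := ∀ p, φ p

/-- `p ⊩ x = y`: whenever `q ≤ p` lies below the condition attached to a member of `x`, it is dense
below `q` that this member equals some member of `y` whose condition is met; and conversely. -/
def eq : PName P → PName P → Sentence P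
  | .mk _ x s, .mk _ y t => fun p =>
    (∀ i, ∀ q ≤ p, q ≤ s i → ∃ r ≤ q, ∃ j, r ≤ t j ∧ eq (x i) (y j) r) ∧
    (∀ j, ∀ q ≤ p, q ≤ t j → ∃ r ≤ q, ∃ i, r ≤ s i ∧ eq (x i) (y j) r)

/-- `p ⊩ x ∈ y`: it is dense below `p` that `x` equals a member of `y` whose condition is met. -/
def mem (x : PName P) : PName P → Sentence P
  | .mk _ y t => fun p => ∀ q ≤ p, ∃ r ≤ q, ∃ j, r ≤ t j ∧ eq x (y j) r

/-- `p ⊩ ¬ φ`. -/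
def neg (φ : Sentence P) : Sentence P := fun p => ∀ q ≤ p, ¬ φ q

/-- `p ⊩ φ ∧ ψ`. -/
def conj (φ ψ : Sentence P) : Sentence P := fun p => φ p ∧ ψ p

/-- `p ⊩ φ → ψ`. -/
def imp (φ ψ : Sentence P) : Sentence P := fun p => ∀ q ≤ p, φ q → ψ q

/-- `p ⊩ φ ↔ ψ`. -/
def equ (φ ψ : Sentence P) : Sentence P := conj (imp φ ψ) (imp ψ φ)

/-- `p ⊩ ∀ i, φ i`, where `i` ranges over names (the sets of the extension) or over some
collection of objects of the ground model. -/
def all {ι : Sort*} (φ : ι → Sentence P) : Sentence P := fun p => ∀ i, φ i p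

/-- `p ⊩ ∃ i, φ i`, where `i` ranges over names (the sets of the extension) or over some
collection of objects of the ground model. -/
def ex {ι : Sort*} (φ : ι → Sentence P) : Sentence P := fun p => ∀ q ≤ p, ∃ r ≤ q, ∃ i, φ i r

end Relation

infix:60 " ≐ " => Forcing.eq
infix:60 " ∊ " => Forcing.mem
infixr:45 " ⩓ " => Forcing.conj
infixr:40 " ⇾ " => Forcing.imp
infix:38 " ⇿ " => Forcing.equ

section Formulas

variable {P : Type u} [Preorder P]

/-- `x ∈ V̌`: the set `x` belongs to the ground model. -/
def inGround (x : PName P) : Sentence P :=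
  ex fun a : PSet.{u} => x ≐ PName.check P a

/-- `f` is single-valued: `(x, y), (x, z) ∈ f` implies `y = z`. -/
def singleValued (f : PName P) : Sentence P :=
  all fun x : PName P => all fun y : PName P => all fun z : PName P =>
    (x.opair y ∊ f) ⇾ (x.opair z ∊ f) ⇾ (y ≐ z)

/-- `f` is a function with domain `d`. -/
def isFunctionOn (f d : PName P) : Sentence P :=
  (all fun z : PName P => (z ∊ f) ⇾
    ex fun x : PName P => ex fun y : PName P => (x ∊ d) ⩓ (z ≐ x.opair y)) ⩓
  (all fun x : PName P => (x ∊ d) ⇾ ex fun y : PName P => x.opair y ∊ f) ⩓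
  singleValued f

/-- `g` is the restriction `f ↾ d`. -/
def isRestriction (g f d : PName P) : Sentence P :=
  all fun z : PName P => (z ∊ g) ⇿
    ((z ∊ f) ⩓ ex fun x : PName P => ex fun y : PName P => (x ∊ d) ⩓ (z ≐ x.opair y))

/-- `f` is a fresh `θ`-sequence: a function with domain `θ` that is not in the ground model although
all its restrictions to ordinals `α < θ` are. -/
noncomputable def isFreshSequence (θ : Ordinal.{u}) (f : PName P) : Sentence P :=
  isFunctionOn f (PName.ord P θ) ⩓ neg (inGround f) ⩓
  all fun α : PName P => (α ∊ PName.ord P θ) ⇾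
    ex fun g : PName P => isRestriction g f α ⩓ inGround g

end Formulas

/-- The notion of forcing `P` adds no fresh `θ`-sequences. -/
def AddsNoFreshSequence (P : Type u) [Preorder P] (θ : Ordinal.{u}) : Prop :=
  Forced (P := P) (neg (ex fun f : PName P => isFreshSequence θ f))

/-- The notion of forcing `P` is nontrivial: it has no atoms, i.e. every condition has two
incompatible extensions. -/
def IsNontrivial (P : Type u) [Preorder P] : Prop :=
  ∀ p : P, ∃ q ≤ p, ∃ r ≤ p, ¬ ∃ s, s ≤ q ∧ s ≤ r

/-! ### Names of notions of forcing and strategic closure -/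

/-- A `P`-name of a notion of forcing: names `carrier` of a set and `le` of a set of pairs such that
`P` forces `le` to be a preorder of `carrier`. -/
structure NotionName (P : Type u) [Preorder P] where
  /-- the underlying set -/
  carrier : PName P
  /-- the order relation, as a set of ordered pairs -/
  le : PName P
  forced_refl : Forced (all fun x : PName P => (x ∊ carrier) ⇾ (x.opair x ∊ le))
  forced_trans : Forced (all fun x : PName P => all fun y : PName P => all fun z : PName P =>
    (x ∊ carrier) ⇾ (y ∊ carrier) ⇾ (z ∊ carrier) ⇾
      (x.opair y ∊ le) ⇾ (y.opair z ∊ le) ⇾ (x.opair z ∊ le))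

/-- The stages at which the second player moves.  The first player makes the very first move, the
players alternate, and the second player moves at limit stages. -/
def SecondMoves (α : Ordinal.{u}) : Prop :=
  α ≠ 0 ∧ ∀ γ : Ordinal.{u}, ∀ _h : γ < α, α = Order.succ γ → ¬ SecondMoves γ
termination_by α

section Game

variable {P : Type u} [Preorder P]

/-- `s` is a position at stage `α` of the game on `Q` in which the second player has obeyed `σ`:
a descending `α`-sequence `s` in `Q` such that `s(ξ) = σ(s ↾ ξ)` for every stage `ξ < α` at which
the second player moves. -/
noncomputable def isPosition (Q : NotionName P) (σ : PName P) (α : Ordinal.{u}) (s : PName P) :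
    Sentence P :=
  isFunctionOn s (PName.ord P α) ⩓
  (all fun x : PName P => all fun y : PName P => (x.opair y ∊ s) ⇾ (y ∊ Q.carrier)) ⩓
  (all fun x : PName P => all fun x' : PName P => all fun y : PName P => all fun y' : PName P =>
    (x ∊ x') ⇾ (x.opair y ∊ s) ⇾ (x'.opair y' ∊ s) ⇾ (y'.opair y ∊ Q.le)) ⩓
  (all fun ξ : {ξ : Ordinal.{u} // ξ < α ∧ SecondMoves ξ} => all fun t : PName P =>
    all fun y : PName P => isRestriction t s (PName.ord P ξ.1) ⇾
      ((PName.ord P ξ.1).opair y ∊ s) ⇾ (t.opair y ∊ σ))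

/-- `σ` is a winning strategy for the second player in the game in which the players build a
descending `(β + 1)`-sequence through `Q`: it is a (possibly partial) function, and at every
position at a stage `α ≤ β` reached by obeying `σ` where the second player has to move, `σ` provides
a legal move, i.e. a condition below all the earlier ones. -/
noncomputable def isWinningStrategy (Q : NotionName P) (β : Ordinal.{u}) (σ : PName P) :
    Sentence P :=
  singleValued σ ⩓
  all fun α : {α : Ordinal.{u} // α ≤ β ∧ SecondMoves α} => all fun s : PName P =>
    isPosition Q σ α.1 s ⇾
      ex fun y : PName P => (y ∊ Q.carrier) ⩓ (s.opair y ∊ σ) ⩓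
        all fun x : PName P => all fun z : PName P => (x.opair z ∊ s) ⇾ (y.opair z ∊ Q.le)

/-- `⊩ Q̇` is `≤β`-strategically closed. -/
def ForcedStrategicallyClosed (Q : NotionName P) (β : Ordinal.{u}) : Prop :=
  Forced (ex fun σ : PName P => isWinningStrategy Q β σ)

end Game

/-! ### The two-step iteration -/

theorem eq_mono {P : Type u} [Preorder P] {x y : PName P} {p q : P} (h : (x ≐ y) p)
    (hq : q ≤ p) : (x ≐ y) q := by
  cases x; cases y
  simp only [eq] at h ⊢
  exact ⟨fun i r hr => h.1 i r (hr.trans hq), fun j r hr => h.2 j r (hr.trans hq)⟩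

theorem mem_mono {P : Type u} [Preorder P] {x y : PName P} {p q : P} (h : (x ∊ y) p)
    (hq : q ≤ p) : (x ∊ y) q := by
  cases y
  exact fun r hr => h r (hr.trans hq)

/-- The conditions of `P * Q̇`: pairs `(p, q̇)` with `p ∈ P`, `q̇ ∈ dom Q̇` and `p ⊩ q̇ ∈ Q̇`. -/
structure Iteration (P : Type u) [Preorder P] (Q : NotionName P) : Type u where
  /-- the first coordinate -/
  fst : P
  /-- the index of the second coordinate in `dom Q̇` -/
  idx : Q.carrier.Index
  forces_mem : (Q.carrier.elem idx ∊ Q.carrier) fst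

namespace Iteration

variable {P : Type u} [Preorder P] {Q : NotionName P}

/-- The second coordinate `q̇` of a condition. -/
def snd (c : Iteration P Q) : PName P := Q.carrier.elem c.idx

/-- `(p, q̇) ≤ (p', q̇')` iff `p ≤ p'` and `p ⊩ q̇ ≤ q̇'`. -/
instance : Preorder (Iteration P Q) where
  le c d := c.fst ≤ d.fst ∧ (c.snd.opair d.snd ∊ Q.le) c.fst
  le_refl c := ⟨le_rfl, Q.forced_refl c.fst c.snd c.fst le_rfl c.forces_mem⟩
  le_trans c d e hcd hde :=
    ⟨hcd.1.trans hde.1,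
      Q.forced_trans c.fst c.snd d.snd e.snd c.fst le_rfl c.forces_mem
        c.fst le_rfl (mem_mono d.forces_mem hcd.1)
        c.fst le_rfl (mem_mono e.forces_mem (hcd.1.trans hde.1))
        c.fst le_rfl hcd.2 c.fst le_rfl (mem_mono hde.2 hcd.1)⟩

end Iteration

end Forcing

/-! Suppose a condition forces `f` to be a fresh `θ`-sequence, and strengthen its first coordinate
until it fixes a name `σ` of a winning strategy. The proof makes two uses of the game, both against
`σ`, and ends by coding a new sequence of bits added by `P` into an initial segment of `f`, which
lies in the ground model.

First use: `P` is enumerated along the first player's stages below `|P|`. At the stage of `p` the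
first player moves, if possible, to a name for which some initial segment of `f` can no longer be
decided below `p` by strengthening the second coordinate alone. A lower bound of this play cannot
fail in this way for every `p`: there are fewer than `cof θ` conditions in `P`, so one initial
segment would be beyond all of them (`exists_not_fails`). A `p` at which it does not fail yields a
condition where the second coordinate alone decides everything (`exists_isUniform`).

Second use: since `f` is not in the ground model, every second coordinate below such a condition has
two strengthenings that decide some value of `f` differently (`IsUniform.exists_split`). Choosing
between the two at each stage of the first player gives a binary tree of plays in the ground model.
Membership of the enumerated conditions in the generic filter is a branch, cut at the least length
`δ` at which it is new (`exists_isBranch_bits`). Its proper initial segments are in the ground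
model, so the play along it obeys `σ` and has a lower bound (`IsBranch.exists_lower_bound`). The at
most `β` many splitting points in the tree are bounded below `θ`, so a condition decides `f` at all
of them, and comparison with the tree recovers the whole branch in the ground model, which is absurd
(`not_isUniform`). -/

namespace Forcing

/-! ### Basic properties of the forcing relation -/

namespace PName

variable {P : Type u}

/-- The condition attached to a member of the domain of a name. -/
def cnd : (x : PName P) → x.Index → P
  | mk _ _ c => c

end PName

section Basic

variable {P : Type u} [Preorder P]

theorem eq_iff {x y : PName P} {p : P} : (x ≐ y) p ↔
    (∀ i, ∀ q ≤ p, q ≤ x.cnd i → ∃ r ≤ q, ∃ j, r ≤ y.cnd j ∧ (x.elem i ≐ y.elem j) r) ∧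
    (∀ j, ∀ q ≤ p, q ≤ y.cnd j → ∃ r ≤ q, ∃ i, r ≤ x.cnd i ∧ (x.elem i ≐ y.elem j) r) := by
  cases x; cases y
  rw [eq]
  rfl

theorem mem_iff {x y : PName P} {p : P} :
    (x ∊ y) p ↔ ∀ q ≤ p, ∃ r ≤ q, ∃ j, r ≤ y.cnd j ∧ (x ≐ y.elem j) r := by
  cases y
  rfl

/-- Both clauses of forced equality only ask for a witness somewhere below each `q`, so a dense set
of conditions suffices. -/
theorem eq_local {x y : PName P} {p : P} (h : ∀ q ≤ p, ∃ r ≤ q, (x ≐ y) r) : (x ≐ y) p := by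
  rw [eq_iff]
  constructor
  · intro i q hq hi
    obtain ⟨r, hr, e⟩ := h q hq
    obtain ⟨s, hs, j, hj, e'⟩ := (eq_iff.1 e).1 i r le_rfl (hr.trans hi)
    exact ⟨s, hs.trans hr, j, hj, e'⟩
  · intro i q hq hi
    obtain ⟨r, hr, e⟩ := h q hq
    obtain ⟨s, hs, j, hj, e'⟩ := (eq_iff.1 e).2 i r le_rfl (hr.trans hi)
    exact ⟨s, hs.trans hr, j, hj, e'⟩

theorem mem_local {x y : PName P} {p : P} (h : ∀ q ≤ p, ∃ r ≤ q, (x ∊ y) r) : (x ∊ y) p := by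
  rw [mem_iff]
  intro q hq
  obtain ⟨r, hr, e⟩ := h q hq
  obtain ⟨s, hs, j, hj, e'⟩ := mem_iff.1 e r le_rfl
  exact ⟨s, hs.trans hr, j, hj, e'⟩

theorem eq_refl (x : PName P) (p : P) : (x ≐ x) p := by
  induction x generalizing p with
  | mk ι n c ih =>
    rw [eq_iff]
    exact ⟨fun i q _ hi => ⟨q, le_rfl, i, hi, ih i q⟩, fun i q _ hi => ⟨q, le_rfl, i, hi, ih i q⟩⟩

theorem eq_symm {x y : PName P} {p : P} (h : (x ≐ y) p) : (y ≐ x) p := by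
  induction x generalizing y p with
  | mk ι n c ih =>
    rw [eq_iff] at h ⊢
    constructor
    · intro i q hq hi
      obtain ⟨r, hr, j, hj, e⟩ := h.2 i q hq hi
      exact ⟨r, hr, j, hj, ih j e⟩
    · intro i q hq hi
      obtain ⟨r, hr, j, hj, e⟩ := h.1 i q hq hi
      exact ⟨r, hr, j, hj, ih i e⟩

theorem eq_trans {x y z : PName P} {p : P} (h : (x ≐ y) p) (h' : (y ≐ z) p) : (x ≐ z) p := by
  induction x generalizing y z p with
  | mk ι n c ih =>
    rw [eq_iff] at h h' ⊢
    constructor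
    · intro i q hq hi
      obtain ⟨r, hr, j, hj, e⟩ := h.1 i q hq hi
      obtain ⟨s, hs, k, hk, e'⟩ := h'.1 j r (hr.trans hq) hj
      exact ⟨s, hs.trans hr, k, hk, ih i (eq_mono e hs) e'⟩
    · intro k q hq hk
      obtain ⟨r, hr, j, hj, e⟩ := h'.2 k q hq hk
      obtain ⟨s, hs, i, hi, e'⟩ := h.2 j r (hr.trans hq) hj
      exact ⟨s, hs.trans hr, i, hi, ih i e' (eq_mono e hs)⟩

theorem mem_congr_left {x y z : PName P} {p : P} (h : (x ≐ y) p) (hx : (x ∊ z) p) :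
    (y ∊ z) p := by
  rw [mem_iff] at hx ⊢
  intro q hq
  obtain ⟨r, hr, j, hj, e⟩ := hx q hq
  exact ⟨r, hr, j, hj, eq_trans (eq_symm (eq_mono h (hr.trans hq))) e⟩

theorem mem_congr_right {x y z : PName P} {p : P} (h : (y ≐ z) p) (hx : (x ∊ y) p) :
    (x ∊ z) p := by
  rw [mem_iff] at hx ⊢
  intro q hq
  obtain ⟨r, hr, j, hj, e⟩ := hx q hq
  obtain ⟨s, hs, k, hk, e'⟩ := (eq_iff.1 h).1 j r (hr.trans hq) hj
  exact ⟨s, hs.trans hr, k, hk, eq_trans (eq_mono e hs) e'⟩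

theorem elem_mem {x : PName P} {i : x.Index} {p : P} (h : p ≤ x.cnd i) : (x.elem i ∊ x) p :=
  mem_iff.2 fun q hq => ⟨q, le_rfl, i, hq.trans h, eq_refl _ _⟩

theorem eq_of_forall_mem {x y : PName P} {p : P}
    (h : ∀ z : PName P, ∀ q ≤ p, (z ∊ x) q → (z ∊ y) q)
    (h' : ∀ z : PName P, ∀ q ≤ p, (z ∊ y) q → (z ∊ x) q) : (x ≐ y) p := by
  rw [eq_iff]
  constructor
  · intro i q hq hi
    exact mem_iff.1 (h _ q hq (elem_mem hi)) q le_rfl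
  · intro i q hq hi
    obtain ⟨r, hr, j, hj, e⟩ := mem_iff.1 (h' _ q hq (elem_mem hi)) q le_rfl
    exact ⟨r, hr, j, hj, eq_symm e⟩

/-! ### Pairs -/

theorem mem_upair {x y z : PName P} {p : P} :
    (z ∊ x.upair y) p ↔ ∀ q ≤ p, ∃ r ≤ q, (z ≐ x) r ∨ (z ≐ y) r := by
  rw [mem_iff]
  constructor
  · intro h q hq
    obtain ⟨r, hr, ⟨b, s⟩, hj, e⟩ := h q hq
    refine ⟨r, hr, ?_⟩
    cases b
    · exact Or.inr e
    · exact Or.inl e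
  · intro h q hq
    obtain ⟨r, hr, e | e⟩ := h q hq
    · exact ⟨r, hr, (true, r), le_rfl, e⟩
    · exact ⟨r, hr, (false, r), le_rfl, e⟩

theorem left_mem_upair (x y : PName P) (p : P) : (x ∊ x.upair y) p :=
  mem_upair.2 fun q _ => ⟨q, le_rfl, Or.inl (eq_refl _ _)⟩

theorem right_mem_upair (x y : PName P) (p : P) : (y ∊ x.upair y) p :=
  mem_upair.2 fun q _ => ⟨q, le_rfl, Or.inr (eq_refl _ _)⟩

theorem upair_congr {x y x' y' : PName P} {p : P} (hx : (x ≐ x') p) (hy : (y ≐ y') p) :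
    (x.upair y ≐ x'.upair y') p := by
  refine eq_of_forall_mem ?_ ?_
  · intro z q hq h
    rw [mem_upair] at h ⊢
    intro r hr
    obtain ⟨s, hs, e⟩ := h r hr
    have hsp := hs.trans (hr.trans hq)
    exact ⟨s, hs, e.imp (fun e => eq_trans e (eq_mono hx hsp))
      (fun e => eq_trans e (eq_mono hy hsp))⟩
  · intro z q hq h
    rw [mem_upair] at h ⊢
    intro r hr
    obtain ⟨s, hs, e⟩ := h r hr
    have hsp := hs.trans (hr.trans hq)
    exact ⟨s, hs, e.imp (fun e => eq_trans e (eq_symm (eq_mono hx hsp)))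
      (fun e => eq_trans e (eq_symm (eq_mono hy hsp)))⟩

theorem opair_congr {x y x' y' : PName P} {p : P} (hx : (x ≐ x') p) (hy : (y ≐ y') p) :
    (x.opair y ≐ x'.opair y') p :=
  upair_congr (upair_congr hx hx) (upair_congr hx hy)

theorem eq_left_of_upair_self_eq {x a b : PName P} {p : P} (h : (x.upair x ≐ a.upair b) p) :
    (x ≐ a) p := by
  have := mem_upair.1 (mem_congr_right (eq_symm h) (left_mem_upair a b p))
  refine eq_local fun q hq => ?_
  obtain ⟨r, hr, e⟩ := this q hq
  exact ⟨r, hr, eq_symm (e.elim id id)⟩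

theorem eq_left_of_opair_eq {x y x' y' : PName P} {p : P} (h : (x.opair y ≐ x'.opair y') p) :
    (x ≐ x') p := by
  have := mem_upair.1 (mem_congr_right h (left_mem_upair (x.upair x) (x.upair y) p))
  refine eq_local fun q hq => ?_
  obtain ⟨r, hr, e⟩ := this q hq
  exact ⟨r, hr, e.elim eq_left_of_upair_self_eq eq_left_of_upair_self_eq⟩

theorem eq_or_eq_of_opair_eq {x y x' y' : PName P} {p : P} (h : (x.opair y ≐ x'.opair y') p) :
    ∃ r ≤ p, (y ≐ x') r ∨ (y ≐ y') r := by
  obtain ⟨r, hr, e⟩ := mem_upair.1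
    (mem_congr_right h (right_mem_upair (x.upair x) (x.upair y) p)) p le_rfl
  have hy := right_mem_upair x y r
  obtain e | e := e
  · obtain ⟨s, hs, e'⟩ := mem_upair.1 (mem_congr_right e hy) r le_rfl
    exact ⟨s, hs.trans hr, Or.inl (e'.elim id id)⟩
  · obtain ⟨s, hs, e'⟩ := mem_upair.1 (mem_congr_right e hy) r le_rfl
    exact ⟨s, hs.trans hr, e'⟩

theorem eq_right_of_opair_eq {x y x' y' : PName P} {p : P} (h : (x.opair y ≐ x'.opair y') p) :
    (y ≐ y') p := by
  refine eq_local fun q hq => ?_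
  have hx := eq_left_of_opair_eq h
  obtain ⟨r, hr, e⟩ := eq_or_eq_of_opair_eq (eq_mono h hq)
  obtain ⟨s, hs, e'⟩ := eq_or_eq_of_opair_eq (eq_symm (eq_mono h (hr.trans hq)))
  refine ⟨s, hs.trans hr, ?_⟩
  -- The only case that needs an argument is `y = x'` and `y' = x`: then `x = x'` closes the chain.
  obtain e | e := e
  · obtain e' | e' := e'
    · exact eq_trans (eq_mono e hs)
        (eq_trans (eq_symm (eq_mono hx (hs.trans (hr.trans hq)))) (eq_symm e'))
    · exact eq_symm e'
  · exact eq_mono e hs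

/-! ### Names of sets of the ground model -/

theorem mem_check {x : PName P} {a : PSet.{u}} {p : P} :
    (x ∊ PName.check P a) p ↔ ∀ q ≤ p, ∃ r ≤ q, ∃ i, (x ≐ PName.check P (a.Func i)) r := by
  cases a with
  | mk α A =>
    rw [PName.check]
    constructor
    · intro h q hq
      obtain ⟨r, hr, j, -, e⟩ := h q hq
      exact ⟨r, hr, j.1, e⟩
    · intro h q hq
      obtain ⟨r, hr, j, e⟩ := h q hq
      exact ⟨r, hr, (j, r), le_rfl, e⟩

theorem check_congr {a b : PSet.{u}} (h : a.Equiv b) (p : P) :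
    (PName.check P a ≐ PName.check P b) p := by
  induction a generalizing b p with
  | mk α A ih =>
    cases b with
    | mk γ B =>
      refine eq_of_forall_mem ?_ ?_
      · intro z q _ hz
        rw [mem_check] at hz ⊢
        intro r hr
        obtain ⟨s, hs, i, e⟩ := hz r hr
        obtain ⟨j, hj⟩ := h.1 i
        exact ⟨s, hs, j, eq_trans e (ih i hj s)⟩
      · intro z q _ hz
        rw [mem_check] at hz ⊢
        intro r hr
        obtain ⟨s, hs, i, e⟩ := hz r hr
        obtain ⟨j, hj⟩ := h.2 i
        exact ⟨s, hs, j, eq_trans e (eq_symm (ih j hj s))⟩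

theorem check_func_mem (a : PSet.{u}) (i : a.Type) (p : P) :
    (PName.check P (a.Func i) ∊ PName.check P a) p :=
  mem_check.2 fun q _ => ⟨q, le_rfl, i, eq_refl _ _⟩

/-- Equality of ground model sets is absolute: a single condition forcing it makes it true. This is
what transfers information between conditions. -/
theorem equiv_of_check_eq {a b : PSet.{u}} {p : P}
    (h : (PName.check P a ≐ PName.check P b) p) : a.Equiv b := by
  induction a generalizing b p with
  | mk α A ih =>
    cases b with
    | mk γ B =>
      constructor
      · intro i
        obtain ⟨r, -, j, e⟩ := mem_check.1
          (mem_congr_right h (check_func_mem ⟨α, A⟩ i p)) p le_rfl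
        exact ⟨j, ih i e⟩
      · intro j
        obtain ⟨r, -, i, e⟩ := mem_check.1
          (mem_congr_right (eq_symm h) (check_func_mem ⟨γ, B⟩ j p)) p le_rfl
        exact ⟨i, ih i (eq_symm e)⟩

theorem mem_ord {x : PName P} {α : Ordinal.{u}} {p : P} :
    (x ∊ PName.ord P α) p ↔ ∀ q ≤ p, ∃ r ≤ q, ∃ γ < α, (x ≐ PName.ord P γ) r := by
  rw [PName.ord, mem_check]
  refine forall₂_congr fun q _ => exists_congr fun r => and_congr_right fun _ => ?_
  constructor
  · rintro ⟨i, e⟩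
    obtain ⟨γ, hγ, h⟩ := Ordinal.mem_toPSet_iff.1 (PSet.func_mem α.toPSet i)
    exact ⟨γ, hγ, eq_trans e (check_congr h r)⟩
  · rintro ⟨γ, hγ, e⟩
    obtain ⟨i, hi⟩ : γ.toPSet ∈ α.toPSet := Ordinal.mem_toPSet_iff.2 ⟨γ, hγ, PSet.Equiv.rfl⟩
    exact ⟨i, eq_trans e (check_congr hi r)⟩

theorem ord_mem {γ α : Ordinal.{u}} (h : γ < α) (p : P) : (PName.ord P γ ∊ PName.ord P α) p :=
  mem_ord.2 fun q _ => ⟨q, le_rfl, γ, h, eq_refl _ _⟩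

theorem ord_inj {γ α : Ordinal.{u}} {p : P} (h : (PName.ord P γ ≐ PName.ord P α) p) : γ = α := by
  have := PSet.rank_congr (equiv_of_check_eq h)
  simpa using this

theorem lt_of_ord_mem {γ α : Ordinal.{u}} {p : P} (h : (PName.ord P γ ∊ PName.ord P α) p) :
    γ < α := by
  obtain ⟨r, -, γ', h', e⟩ := mem_ord.1 h p le_rfl
  rwa [ord_inj e]

/-- The unordered pair of two pre-sets. -/
def groundUpair (a b : PSet.{u}) : PSet.{u} := ⟨ULift Bool, fun i => cond i.down a b⟩

/-- The Kuratowski pair of two pre-sets. -/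
def groundOpair (a b : PSet.{u}) : PSet.{u} := groundUpair (groundUpair a a) (groundUpair a b)

theorem check_groundUpair (a b : PSet.{u}) (p : P) :
    (PName.check P (groundUpair a b) ≐ (PName.check P a).upair (PName.check P b)) p := by
  refine eq_of_forall_mem ?_ ?_
  · intro z q _ h
    rw [mem_check] at h
    rw [mem_upair]
    intro r hr
    obtain ⟨s, hs, ⟨i⟩, e⟩ := h r hr
    refine ⟨s, hs, ?_⟩
    cases i
    · exact Or.inr e
    · exact Or.inl e
  · intro z q _ h
    rw [mem_check]
    rw [mem_upair] at h
    intro r hr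
    obtain ⟨s, hs, e | e⟩ := h r hr
    · exact ⟨s, hs, ⟨true⟩, e⟩
    · exact ⟨s, hs, ⟨false⟩, e⟩

theorem check_groundOpair (a b : PSet.{u}) (p : P) :
    (PName.check P (groundOpair a b) ≐ (PName.check P a).opair (PName.check P b)) p :=
  eq_trans (check_groundUpair _ _ p) (upair_congr (check_groundUpair _ _ p)
    (check_groundUpair _ _ p))

/-- If an ordered pair is in the ground model, so is its second coordinate. -/
theorem exists_eq_check_of_opair_eq {x y : PName P} {a : PSet.{u}} {p : P}
    (h : (x.opair y ≐ PName.check P a) p) : ∃ r ≤ p, ∃ v : PSet.{u}, (y ≐ PName.check P v) r := by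
  obtain ⟨r, hr, i, e⟩ := mem_check.1
    (mem_congr_right h (right_mem_upair (x.upair x) (x.upair y) p)) p le_rfl
  obtain ⟨s, hs, j, e'⟩ := mem_check.1 (mem_congr_right e (right_mem_upair x y r)) r le_rfl
  exact ⟨s, hs.trans hr, _, e'⟩

/-! ### The maximum principle -/

/-- A property of names that behaves like a formula of the forcing language. -/
structure IsFormula (φ : PName P → Sentence P) : Prop where
  mono : ∀ {x p q}, φ x p → q ≤ p → φ x q
  dense : ∀ {x p}, (∀ q ≤ p, ∃ r ≤ q, φ x r) → φ x p
  congr : ∀ {x y p}, (x ≐ y) p → φ x p → φ y p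

/-- Two conditions with a common extension. -/
def Compat (p q : P) : Prop := ∃ s, s ≤ p ∧ s ≤ q

theorem exists_maximal_antichain (D : Set P) : ∃ A ⊆ D,
    (∀ a ∈ A, ∀ b ∈ A, Compat a b → a = b) ∧ ∀ d ∈ D, ∃ a ∈ A, Compat a d := by
  obtain ⟨A, hA⟩ := zorn_subset
    {A : Set P | A ⊆ D ∧ ∀ a ∈ A, ∀ b ∈ A, Compat a b → a = b} (by
      intro C hC hchain
      refine ⟨⋃₀ C, ⟨Set.sUnion_subset fun A hA => (hC hA).1, ?_⟩,
        fun A hA => Set.subset_sUnion_of_mem hA⟩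
      rintro a ⟨A, hA, ha⟩ b ⟨B, hB, hb⟩ hab
      obtain h | h := hchain.total hA hB
      · exact (hC hB).2 a (h ha) b hb hab
      · exact (hC hA).2 a ha b (h hb) hab)
  refine ⟨A, hA.prop.1, hA.prop.2, fun d hd => ?_⟩
  by_contra! hcon
  have hins : insert d A ∈ {A : Set P | A ⊆ D ∧ ∀ a ∈ A, ∀ b ∈ A, Compat a b → a = b} := by
    refine ⟨Set.insert_subset hd hA.prop.1, ?_⟩
    rintro a (rfl | ha) b (rfl | hb) hab
    · rfl
    · exact absurd (hab.imp fun s h => h.symm) (hcon b hb)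
    · exact absurd hab (hcon a ha)
    · exact hA.prop.2 a ha b hb hab
  have hdA : d ∈ A := hA.le_of_ge hins (Set.subset_insert d A) (Set.mem_insert d A)
  exact hcon d hdA ⟨d, le_rfl, le_rfl⟩

/-- Mixing of names along an antichain. -/
theorem exists_mix (A : Set P) (hA : ∀ a ∈ A, ∀ b ∈ A, Compat a b → a = b) (x : P → PName P) :
    ∃ y : PName P, ∀ a ∈ A, (y ≐ x a) a := by
  -- Each member of `x a` is kept only with conditions below `a`; by incompatibility the members
  -- coming from other elements of `A` are invisible below `a`.
  refine ⟨.mk {k : Σ a : A, (x a).Index × P // k.2.2 ≤ k.1 ∧ k.2.2 ≤ (x k.1).cnd k.2.1}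
    (fun k => (x k.1.1).elem k.1.2.1) (fun k => k.1.2.2), fun a ha => ?_⟩
  refine eq_iff.2 ⟨?_, ?_⟩
  · rintro ⟨⟨b, j, s⟩, hs, hs'⟩ q hq hqs
    have hqs : q ≤ s := hqs
    have hab : a = b := hA a ha b b.2 ⟨q, hq, hqs.trans hs⟩
    subst hab
    exact ⟨q, le_rfl, j, hqs.trans hs', eq_refl _ _⟩
  · intro j q hq hj
    exact ⟨q, le_rfl, ⟨⟨⟨a, ha⟩, j, q⟩, hq, hj⟩, le_rfl, eq_refl _ _⟩

/-- Witnesses are mixed along a maximal antichain of conditions that have one; the mixture is a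
witness densely below `p`, hence at `p`. -/
theorem IsFormula.exists_of_ex {φ : PName P → Sentence P} (hφ : IsFormula φ) {p : P}
    (h : ex φ p) : ∃ y, φ y p := by
  classical
  obtain ⟨A, hAD, hA, hmax⟩ := exists_maximal_antichain {r : P | ∃ y, φ y r}
  have : Nonempty (PName P) := ⟨.mk PEmpty PEmpty.elim PEmpty.elim⟩
  choose! x hx using hAD
  obtain ⟨y, hy⟩ := exists_mix A hA x
  refine ⟨y, hφ.dense fun q hq => ?_⟩
  obtain ⟨r, hr, hrD⟩ := h q hq
  obtain ⟨a, ha, s, hsa, hsr⟩ := hmax r hrD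
  exact ⟨s, hsr.trans hr, hφ.congr (eq_symm (eq_mono (hy a ha) hsa)) (hφ.mono (hx ha) hsa)⟩

end Basic

/-! ### Fresh sequences in terms of decided values -/

section Fresh

variable {P : Type u} [Preorder P]

/-- `Decides f p γ v`: the condition `p` forces that `f(γ) = v̌`. -/
noncomputable def Decides (f : PName P) (p : P) (γ : Ordinal.{u}) (v : ZFSet.{u}) : Prop :=
  ((PName.ord P γ).opair (PName.check P (Quotient.out v)) ∊ f) p

theorem Decides.mono {f : PName P} {p q : P} {γ : Ordinal.{u}} {v : ZFSet.{u}}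
    (h : Decides f p γ v) (hq : q ≤ p) : Decides f q γ v :=
  mem_mono h hq

theorem Decides.of_dense {f : PName P} {p : P} {γ : Ordinal.{u}} {v : ZFSet.{u}}
    (h : ∀ q ≤ p, ∃ r ≤ q, Decides f r γ v) : Decides f p γ v :=
  mem_local h

theorem decides_mk {f : PName P} {p : P} {γ : Ordinal.{u}} {a : PSet.{u}}
    (h : ((PName.ord P γ).opair (PName.check P a) ∊ f) p) : Decides f p γ (ZFSet.mk a) :=
  mem_congr_left (opair_congr (eq_refl _ _)
    (check_congr (PSet.Equiv.symm (Quotient.mk_out (s := PSet.setoid) a)) p)) h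

variable {θ : Ordinal.{u}} {f : PName P} {p₀ : P}

theorem Decides.unique {p : P} (hf : singleValued f p₀) (hp : p ≤ p₀) {γ : Ordinal.{u}}
    {v w : ZFSet.{u}} (hv : Decides f p γ v) (hw : Decides f p γ w) : v = w := by
  have := hf _ _ _ p hp hv p le_rfl hw
  exact Quotient.out_equiv_out.1 (equiv_of_check_eq this)

theorem exists_decides_lt (hf : isFreshSequence θ f p₀) {p : P} (hp : p ≤ p₀) {α : Ordinal.{u}}
    (hα : α < θ) :
    ∃ q ≤ p, ∃ a : Ordinal.{u} → ZFSet.{u}, ∀ γ < α, Decides f q γ (a γ) := by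
  obtain ⟨⟨-, hdom, -⟩, -, hseg⟩ := hf
  obtain ⟨q, hq, g, hg, hgV⟩ := hseg (PName.ord P α) p hp (ord_mem hα p) p le_rfl
  obtain ⟨r, hr, A, hA⟩ := hgV q le_rfl
  have key : ∀ γ < α, ∃ v, Decides f r γ v := by
    intro γ hγ
    have hrp := hr.trans (hq.trans hp)
    obtain ⟨s, hs, y, hy⟩ := hdom (PName.ord P γ) r hrp (ord_mem (hγ.trans hα) r) r le_rfl
    have hyg := (hg _).2 s (hs.trans hr) ⟨hy, fun t _ => ⟨t, le_rfl, PName.ord P γ,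
      fun t' _ => ⟨t', le_rfl, y, ord_mem hγ t', eq_refl _ _⟩⟩⟩
    obtain ⟨t, ht, i, e⟩ := mem_check.1 (mem_congr_right (eq_mono hA hs) hyg) s le_rfl
    obtain ⟨t', ht', v, ev⟩ := exists_eq_check_of_opair_eq e
    -- The pair is found to be an element of `A` only below `t'`, but this is a fact about the
    -- ground model, so it already holds at `r`.
    have e' : (PName.check P (groundOpair γ.toPSet v) ≐ PName.check P (A.Func i)) t' :=
      eq_trans (check_groundOpair _ _ t') (eq_trans (opair_congr (eq_refl _ _) (eq_symm ev))
        (eq_mono e ht'))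
    have hmem : ((PName.ord P γ).opair (PName.check P v) ∊ PName.check P A) r :=
      mem_congr_left (eq_trans (eq_symm (check_congr (equiv_of_check_eq e') r))
        (check_groundOpair _ _ r)) (check_func_mem A i r)
    exact ⟨_, decides_mk ((hg _).1 r hr (mem_congr_right (eq_symm hA) hmem)).1⟩
  choose! a ha using key
  exact ⟨r, hr.trans hq, a, ha⟩

/-- Otherwise the graph of `a` on `θ`, a set of the ground model, would be forced to equal `f`. -/
theorem not_forall_decides (hf : isFreshSequence θ f p₀) {p : P} (hp : p ≤ p₀)
    (a : Ordinal.{u} → ZFSet.{u}) : ¬ ∀ γ < θ, Decides f p γ (a γ) := by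
  intro h
  obtain ⟨⟨hpair, -, hsv⟩, hnot, -⟩ := hf
  refine hnot p hp fun q hq => ⟨q, le_rfl,
    ⟨θ.ToType, fun i => groundOpair (Ordinal.toPSet i) (Quotient.out (a i))⟩, ?_⟩
  refine eq_of_forall_mem ?_ ?_
  · intro z r hr hz
    rw [mem_check]
    intro s hs
    have hsp : s ≤ p := hs.trans (hr.trans hq)
    obtain ⟨t, ht, x, hx⟩ := hpair z r (hr.trans (hq.trans hp)) hz s hs
    obtain ⟨t₁, ht₁, y, hxθ, e⟩ := hx t le_rfl
    obtain ⟨t₂, ht₂, γ, hγ, e'⟩ := mem_ord.1 hxθ t₁ le_rfl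
    have ht₂s : t₂ ≤ s := ht₂.trans (ht₁.trans ht)
    refine ⟨t₂, ht₂s, Ordinal.ToType.mk ⟨γ, hγ⟩, ?_⟩
    have e₂ : (z ≐ (PName.ord P γ).opair y) t₂ :=
      eq_trans (eq_mono e ht₂) (opair_congr e' (eq_refl _ _))
    have ey := hsv _ _ _ t₂ (ht₂s.trans (hsp.trans hp))
      (mem_congr_left e₂ (mem_mono hz (ht₂s.trans hs))) t₂ le_rfl
      (mem_mono (h γ hγ) (ht₂s.trans hsp))
    refine eq_trans e₂ (eq_trans (opair_congr (eq_refl _ _) ey) (eq_symm ?_))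
    simpa [PName.ord] using check_groundOpair γ.toPSet (Quotient.out (a γ)) t₂
  · intro z r hr hz
    refine mem_local fun s hs => ?_
    obtain ⟨t, ht, i, e⟩ := mem_check.1 hz s hs
    refine ⟨t, ht, mem_congr_left (eq_symm (eq_trans e (check_groundOpair _ _ t)))
      (mem_mono (h _ (Ordinal.ToType.mk.symm i).2) (ht.trans (hs.trans (hr.trans hq))))⟩

end Fresh

/-! ### Names of sequences -/

section Sequences

variable {P : Type u}

/-- The name of the `δ`-sequence whose value at `γ` is `F γ s` whenever a condition `s` with `ok γ s`
is in the generic filter. -/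
noncomputable def seqName (δ : Ordinal.{u}) (F : Ordinal.{u} → P → PName P)
    (ok : Ordinal.{u} → P → Prop) : PName P :=
  .mk {k : δ.ToType × P // ok k.1 k.2} (fun k => (PName.ord P k.1.1).opair (F k.1.1 k.1.2))
    (fun k => k.1.2)

variable {δ : Ordinal.{u}} {F : Ordinal.{u} → P → PName P} {ok : Ordinal.{u} → P → Prop}

theorem seqName_congr {F' : Ordinal.{u} → P → PName P} (h : ∀ γ < δ, ∀ s, F γ s = F' γ s) :
    seqName δ F ok = seqName δ F' ok := by
  unfold seqName
  congr 1
  funext k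
  rw [h _ (Ordinal.ToType.mk.symm k.1.1).2]

variable [Preorder P]

theorem mem_seqName {z : PName P} {p : P} : (z ∊ seqName δ F ok) p ↔ ∀ q ≤ p, ∃ r ≤ q,
    ∃ γ < δ, ∃ s, ok γ s ∧ r ≤ s ∧ (z ≐ (PName.ord P γ).opair (F γ s)) r := by
  rw [mem_iff]
  refine forall₂_congr fun q _ => exists_congr fun r => and_congr_right fun _ => ?_
  constructor
  · rintro ⟨⟨⟨i, s⟩, h⟩, hrs, e⟩
    exact ⟨_, (Ordinal.ToType.mk.symm i).2, s, h, hrs, e⟩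
  · rintro ⟨γ, hγ, s, h, hrs, e⟩
    refine ⟨⟨⟨Ordinal.ToType.mk ⟨γ, hγ⟩, s⟩, by simpa using h⟩, hrs, ?_⟩
    change (z ≐ (PName.ord P _).opair (F _ s)) r
    simpa using e

theorem opair_mem_seqName {x y : PName P} {p : P} : (x.opair y ∊ seqName δ F ok) p ↔
    ∀ q ≤ p, ∃ r ≤ q, ∃ γ < δ, ∃ s, ok γ s ∧ r ≤ s ∧ (x ≐ PName.ord P γ) r ∧ (y ≐ F γ s) r := by
  rw [mem_seqName]
  refine forall₂_congr fun q _ => exists_congr fun r => and_congr_right fun _ =>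
    exists_congr fun γ => and_congr_right fun _ => exists_congr fun s => and_congr_right fun _ =>
    and_congr_right fun _ => ?_
  exact ⟨fun e => ⟨eq_left_of_opair_eq e, eq_right_of_opair_eq e⟩, fun e => opair_congr e.1 e.2⟩

theorem opair_mem_seqName_of_ok {γ : Ordinal.{u}} (hγ : γ < δ) {p s : P} (hs : ok γ s)
    (hp : p ≤ s) : ((PName.ord P γ).opair (F γ s) ∊ seqName δ F ok) p :=
  opair_mem_seqName.2 fun q hq =>
    ⟨q, le_rfl, γ, hγ, s, hs, hq.trans hp, eq_refl _ _, eq_refl _ _⟩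

theorem seqName_eq_seqName {F' : Ordinal.{u} → P → PName P} {ok' : Ordinal.{u} → P → Prop} {p : P}
    (hd : ∀ γ < δ, ∀ q ≤ p, ∃ r ≤ q, ok γ r) (hd' : ∀ γ < δ, ∀ q ≤ p, ∃ r ≤ q, ok' γ r)
    (h : ∀ γ < δ, ∀ s s' r, ok γ s → ok' γ s' → r ≤ p → r ≤ s → r ≤ s' → F γ s = F' γ s') :
    (seqName δ F ok ≐ seqName δ F' ok') p := by
  refine eq_of_forall_mem ?_ ?_
  · intro z q hq hz
    rw [mem_seqName] at hz ⊢
    intro r hr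
    obtain ⟨t, ht, γ, hγ, s, hs, hts, e⟩ := hz r hr
    have htp := ht.trans (hr.trans hq)
    obtain ⟨s', hs't, hs'⟩ := hd' γ hγ t htp
    refine ⟨s', hs't.trans ht, γ, hγ, s', hs', le_rfl, ?_⟩
    rw [← h γ hγ s s' s' hs hs' (hs't.trans htp) (hs't.trans hts) le_rfl]
    exact eq_mono e hs't
  · intro z q hq hz
    rw [mem_seqName] at hz ⊢
    intro r hr
    obtain ⟨t, ht, γ, hγ, s, hs, hts, e⟩ := hz r hr
    have htp := ht.trans (hr.trans hq)
    obtain ⟨s', hs't, hs'⟩ := hd γ hγ t htp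
    refine ⟨s', hs't.trans ht, γ, hγ, s', hs', le_rfl, ?_⟩
    rw [h γ hγ s' s s' hs' hs (hs't.trans htp) le_rfl (hs't.trans hts)]
    exact eq_mono e hs't

theorem eq_seqName_of_isRestriction {t : PName P} {ξ : Ordinal.{u}} (hξ : ξ ≤ δ) {p : P}
    (h : isRestriction t (seqName δ F ok) (PName.ord P ξ) p) : (t ≐ seqName ξ F ok) p := by
  refine eq_of_forall_mem ?_ ?_
  · intro z q hq hz
    obtain ⟨hz₁, hz₂⟩ := (h z).1 q hq hz
    rw [mem_seqName] at hz₁ ⊢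
    intro r hr
    obtain ⟨r₁, hr₁, γ, hγ, s, hs, hrs, e⟩ := hz₁ r hr
    obtain ⟨r₂, hr₂, x, hx⟩ := hz₂ r₁ (hr₁.trans hr)
    obtain ⟨r₃, hr₃, y, hxξ, e'⟩ := hx r₂ le_rfl
    obtain ⟨r₄, hr₄, γ', hγ', e''⟩ := mem_ord.1 hxξ r₃ le_rfl
    have h₄₁ := hr₄.trans (hr₃.trans hr₂)
    have e₁ := eq_left_of_opair_eq (eq_trans (eq_symm (eq_mono e h₄₁)) (eq_mono e' hr₄))
    have : γ = γ' := ord_inj (eq_trans e₁ e'')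
    subst this
    exact ⟨r₄, h₄₁.trans hr₁, γ, hγ', s, hs, h₄₁.trans hrs, eq_mono e h₄₁⟩
  · intro z q hq hz
    rw [mem_seqName] at hz
    refine (h z).2 q hq ⟨?_, ?_⟩
    · rw [mem_seqName]
      intro r hr
      obtain ⟨r₁, hr₁, γ, hγ, hrest⟩ := hz r hr
      exact ⟨r₁, hr₁, γ, hγ.trans_le hξ, hrest⟩
    · intro r hr
      obtain ⟨r₁, hr₁, γ, hγ, s, -, -, e⟩ := hz r hr
      exact ⟨r₁, hr₁, _, fun r₂ hr₂ => ⟨r₂, le_rfl, _, ord_mem hγ r₂, eq_mono e hr₂⟩⟩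

end Sequences

/-! ### Positions of the game -/

section Game

variable {P : Type u} [Preorder P]

namespace NotionName

variable (Q : NotionName P)

/-- `p ⊩ x ∈ Q̇`. -/
def Mem (x : PName P) (p : P) : Prop := (x ∊ Q.carrier) p

/-- `p ⊩ x ≤ y` in `Q̇`. -/
def Le (x y : PName P) (p : P) : Prop := (x.opair y ∊ Q.le) p

variable {Q}

theorem Mem.mono {x : PName P} {p q : P} (h : Q.Mem x p) (hq : q ≤ p) : Q.Mem x q := mem_mono h hq

theorem Le.mono {x y : PName P} {p q : P} (h : Q.Le x y p) (hq : q ≤ p) : Q.Le x y q :=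
  mem_mono h hq

theorem Mem.congr {x y : PName P} {p : P} (e : (x ≐ y) p) (h : Q.Mem x p) : Q.Mem y p :=
  mem_congr_left e h

theorem Le.congr {x y x' y' : PName P} {p : P} (e : (x ≐ x') p) (e' : (y ≐ y') p)
    (h : Q.Le x y p) : Q.Le x' y' p :=
  mem_congr_left (opair_congr e e') h

theorem Mem.le_refl {x : PName P} {p : P} (h : Q.Mem x p) : Q.Le x x p :=
  Q.forced_refl p x p le_rfl h

theorem Le.trans {x y z : PName P} {p : P} (hx : Q.Mem x p) (hy : Q.Mem y p) (hz : Q.Mem z p)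
    (hxy : Q.Le x y p) (hyz : Q.Le y z p) : Q.Le x z p :=
  Q.forced_trans p x y z p le_rfl hx p le_rfl hy p le_rfl hz p le_rfl hxy p le_rfl hyz

theorem Mem.exists_condition {x : PName P} {p : P} (h : Q.Mem x p) :
    ∃ c : Iteration P Q, c.fst ≤ p ∧ (c.snd ≐ x) c.fst := by
  obtain ⟨r, hr, j, hj, e⟩ := mem_iff.1 h p le_rfl
  exact ⟨⟨r, j, elem_mem hj⟩, hr, eq_symm e⟩

end NotionName

variable {Q : NotionName P} {σ : PName P}

/-- The clauses defining a position are reduced to facts about the names `F γ s` below conditions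
where `ok γ s` holds. It serves both for plays along a branch of the ground model (`ok` trivial) and
along a merely named one. -/
theorem isPosition_seqName {δ : Ordinal.{u}} {F : Ordinal.{u} → P → PName P}
    {ok : Ordinal.{u} → P → Prop} {p : P}
    (hdense : ∀ γ < δ, ∀ q ≤ p, ∃ r ≤ q, ok γ r)
    (hcoh : ∀ γ < δ, ∀ s s' r, ok γ s → ok γ s' → r ≤ p → r ≤ s → r ≤ s' → F γ s = F γ s')
    (hmem : ∀ γ < δ, ∀ s, ok γ s → ∀ r, r ≤ p → r ≤ s → Q.Mem (F γ s) r)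
    (hle : ∀ γ' < δ, ∀ γ < γ', ∀ s s' r, ok γ s → ok γ' s' → r ≤ p → r ≤ s → r ≤ s' →
      Q.Le (F γ' s') (F γ s) r)
    (hobey : ∀ γ < δ, SecondMoves γ → ∀ s, ok γ s → ∀ r, r ≤ p → r ≤ s →
      ((seqName γ F ok).opair (F γ s) ∊ σ) r) :
    isPosition Q σ δ (seqName δ F ok) p := by
  refine ⟨⟨?_, ?_, ?_⟩, ?_, ?_, ?_⟩
  · intro z q hq hz r hr
    obtain ⟨r₁, hr₁, γ, hγ, s, -, -, e⟩ := mem_seqName.1 hz r hr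
    exact ⟨r₁, hr₁, _, fun r₂ hr₂ => ⟨r₂, le_rfl, _, ord_mem hγ r₂, eq_mono e hr₂⟩⟩
  · intro x q hq hx r hr
    obtain ⟨r₁, hr₁, γ, hγ, e⟩ := mem_ord.1 hx r hr
    obtain ⟨s, hs, hok⟩ := hdense γ hγ r₁ (hr₁.trans (hr.trans hq))
    exact ⟨s, hs.trans hr₁, F γ s, mem_congr_left (opair_congr (eq_symm (eq_mono e hs))
      (eq_refl _ _)) (opair_mem_seqName_of_ok hγ hok le_rfl)⟩
  · intro x y z q hq hy q' hq' hz
    refine eq_local fun r hr => ?_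
    obtain ⟨r₁, hr₁, γ, hγ, s, hs, hrs, ex, ey⟩ := opair_mem_seqName.1 hy r (hr.trans hq')
    obtain ⟨r₂, hr₂, γ', hγ', s', hs', hrs', ex', ez⟩ :=
      opair_mem_seqName.1 hz r₁ (hr₁.trans hr)
    have : γ = γ' := ord_inj (eq_trans (eq_symm (eq_mono ex hr₂)) ex')
    subst this
    rw [← hcoh γ hγ s s' r₂ hs hs' (hr₂.trans (hr₁.trans (hr.trans (hq'.trans hq))))
      (hr₂.trans hrs) hrs'] at ez
    exact ⟨r₂, hr₂.trans hr₁, eq_trans (eq_mono ey hr₂) (eq_symm ez)⟩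
  · intro x y q hq hy
    refine mem_local fun r hr => ?_
    obtain ⟨r₁, hr₁, γ, hγ, s, hs, hrs, ex, ey⟩ := opair_mem_seqName.1 hy r hr
    exact ⟨r₁, hr₁, mem_congr_left (eq_symm ey)
      (hmem γ hγ s hs r₁ (hr₁.trans (hr.trans hq)) hrs)⟩
  · intro x x' y y' q hq hx q₁ hq₁ hy q₂ hq₂ hy'
    refine mem_local fun r hr => ?_
    obtain ⟨r₁, hr₁, γ, hγ, s, hs, hrs, ex, ey⟩ := opair_mem_seqName.1 hy r (hr.trans hq₂)
    obtain ⟨r₂, hr₂, γ', hγ', s', hs', hrs', ex', ey'⟩ :=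
      opair_mem_seqName.1 hy' r₁ (hr₁.trans hr)
    have hlt : γ < γ' := lt_of_ord_mem (P := P) (p := r₂) (mem_congr_left (eq_mono ex hr₂)
      (mem_congr_right ex' (mem_mono hx (hr₂.trans (hr₁.trans (hr.trans (hq₂.trans hq₁)))))))
    exact ⟨r₂, hr₂.trans hr₁, mem_congr_left
      (opair_congr (eq_symm ey') (eq_symm (eq_mono ey hr₂)))
      (hle γ' hγ' γ hlt s s' r₂ hs hs'
        (hr₂.trans (hr₁.trans (hr.trans (hq₂.trans (hq₁.trans hq))))) (hr₂.trans hrs) hrs')⟩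
  · rintro ⟨ξ, hξ, hsecond⟩ t y q hq ht q₁ hq₁ hy
    refine mem_local fun r hr => ?_
    obtain ⟨r₁, hr₁, γ, hγ, s, hs, hrs, ex, ey⟩ := opair_mem_seqName.1 hy r hr
    have : ξ = γ := ord_inj ex
    subst this
    have e := eq_mono (eq_seqName_of_isRestriction hξ.le ht) (hr₁.trans (hr.trans hq₁))
    exact ⟨r₁, hr₁, mem_congr_left (opair_congr (eq_symm e) (eq_symm ey))
      (hobey ξ hγ hsecond s hs r₁ (hr₁.trans (hr.trans (hq₁.trans hq))) hrs)⟩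

/-! ### The tree of plays against a strategy -/

/-- `y` is a legal move of the second player at the position `s` that obeys `σ`. -/
def isAnswer (Q : NotionName P) (σ s y : PName P) : Sentence P :=
  (y ∊ Q.carrier) ⩓ (s.opair y ∊ σ) ⩓
    all fun x : PName P => all fun z : PName P => (x.opair z ∊ s) ⇾ (y.opair z ∊ Q.le)

theorem isFormula_isAnswer (s : PName P) : IsFormula (isAnswer Q σ s) where
  mono h hq := ⟨mem_mono h.1 hq, mem_mono h.2.1 hq, fun x z r hr => h.2.2 x z r (hr.trans hq)⟩
  dense h := by
    refine ⟨mem_local fun q hq => ?_, mem_local fun q hq => ?_, fun x z q hq hz =>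
      mem_local fun r hr => ?_⟩
    · exact (h q hq).imp fun r hr => ⟨hr.1, hr.2.1⟩
    · exact (h q hq).imp fun r hr => ⟨hr.1, hr.2.2.1⟩
    · exact (h r (hr.trans hq)).imp fun t ht =>
        ⟨ht.1, ht.2.2.2 x z t le_rfl (mem_mono hz (ht.1.trans hr))⟩
  congr e h := ⟨mem_congr_left e h.1, mem_congr_left (opair_congr (eq_refl _ _) e) h.2.1,
    fun x z q hq hz => mem_congr_left (opair_congr (eq_mono e hq) (eq_refl _ _))
      (h.2.2 x z q hq hz)⟩

theorem secondMoves_iff {α : Ordinal.{u}} :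
    SecondMoves α ↔ α ≠ 0 ∧ ∀ γ < α, α = Order.succ γ → ¬ SecondMoves γ := by
  rw [SecondMoves]

theorem secondMoves_succ {α : Ordinal.{u}} : SecondMoves (Order.succ α) ↔ ¬ SecondMoves α := by
  rw [secondMoves_iff]
  constructor
  · exact fun h => h.2 α (Order.lt_succ α) rfl
  · refine fun h => ⟨(Order.bot_lt_succ α).ne', fun γ _ e => ?_⟩
    rwa [← Order.succ_injective e]

theorem secondMoves_of_isSuccLimit {α : Ordinal.{u}} (h : Order.IsSuccLimit α) :
    SecondMoves α := by
  refine secondMoves_iff.2 ⟨fun h0 => h.1 (h0 ▸ isMin_bot), fun γ _ e => ?_⟩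
  exact absurd e.symm (h.succ_ne γ)

theorem eq_zero_or_eq_succ {α : Ordinal.{u}} (h : ¬ SecondMoves α) :
    α = 0 ∨ ∃ γ, α = Order.succ γ := by
  obtain h' | ⟨γ, h'⟩ | h' := Ordinal.zero_or_succ_or_isSuccLimit α
  · exact Or.inl h'
  · exact Or.inr ⟨γ, h'.symm⟩
  · exact absurd (secondMoves_of_isSuccLimit h') h

open Classical in
/-- A move of the second player at `s` that `p` forces to obey `σ`, if there is one. -/
noncomputable def answer (Q : NotionName P) (σ : PName P) (p : P) (s : PName P) : PName P :=
  if h : ∃ y, isAnswer Q σ s y p then h.choose else s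

theorem isAnswer_answer {β α : Ordinal.{u}} {p : P} (hσ : isWinningStrategy Q β σ p)
    (hα : α ≤ β) (hs : SecondMoves α) {s : PName P} (h : isPosition Q σ α s p) :
    isAnswer Q σ s (answer Q σ p s) p := by
  have : ∃ y, isAnswer Q σ s y p :=
    (isFormula_isAnswer s).exists_of_ex (hσ.2 ⟨α, hα, hs⟩ s p le_rfl h)
  rw [answer, dif_pos this]
  exact this.choose_spec

open Classical in
/-- The tree of plays in which the second player obeys `σ` and the first player, at a stage `γ`,
replies `M γ (t γ) x` to the previous move `x`, where the branch is given by `t`. -/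
noncomputable def play (Q : NotionName P) (σ : PName P) (p : P) (x₀ : PName P)
    (M : Ordinal.{u} → Bool → PName P → PName P) (t : Ordinal.{u} → Bool) (γ : Ordinal.{u}) :
    PName P :=
  if SecondMoves γ then
    answer Q σ p (seqName γ
      (fun γ' _ => if _h : γ' < γ then play Q σ p x₀ M t γ' else x₀) (fun _ _ => True))
  -- The default `x₀` matters at stage `0`, where the first player replies to the starting
  -- condition; limit stages belong to the other player.
  else M γ (t γ) (if _h : γ.pred < γ then play Q σ p x₀ M t γ.pred else x₀)
termination_by γ

variable {p₀ : P} {x₀ : PName P} {M : Ordinal.{u} → Bool → PName P → PName P}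
  {t : Ordinal.{u} → Bool} {γ : Ordinal.{u}}

open Classical in
/-- The move to which the first player replies at stage `γ` of a play. -/
noncomputable def prevMove (Q : NotionName P) (σ : PName P) (p : P) (x₀ : PName P)
    (M : Ordinal.{u} → Bool → PName P → PName P) (t : Ordinal.{u} → Bool) (γ : Ordinal.{u}) :
    PName P :=
  if γ.pred < γ then play Q σ p x₀ M t γ.pred else x₀

theorem play_of_secondMoves (h : SecondMoves γ) : play Q σ p₀ x₀ M t γ =
    answer Q σ p₀ (seqName γ (fun γ' _ => play Q σ p₀ x₀ M t γ') (fun _ _ => True)) := by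
  rw [play, if_pos h]
  congr 1
  exact seqName_congr fun γ' h' _ => dif_pos h'

theorem play_of_not_secondMoves (h : ¬ SecondMoves γ) :
    play Q σ p₀ x₀ M t γ = M γ (t γ) (prevMove Q σ p₀ x₀ M t γ) := by
  rw [play, if_neg h]
  rfl

theorem prevMove_zero : prevMove Q σ p₀ x₀ M t 0 = x₀ :=
  if_neg (not_lt.2 (zero_le))

theorem prevMove_succ : prevMove Q σ p₀ x₀ M t (Order.succ γ) = play Q σ p₀ x₀ M t γ := by
  rw [prevMove, Order.succ_eq_add_one, Ordinal.pred_add_one, if_pos (lt_add_one γ)]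

/-- The plays form a tree: the recursion for stage `γ` consults the branch only up to `γ`. -/
theorem play_congr {t' : Ordinal.{u} → Bool} (h : ∀ ξ ≤ γ, t ξ = t' ξ) :
    play Q σ p₀ x₀ M t γ = play Q σ p₀ x₀ M t' γ := by
  induction γ using WellFoundedLT.induction with
  | ind γ ih =>
    have ih' : ∀ ξ < γ, play Q σ p₀ x₀ M t ξ = play Q σ p₀ x₀ M t' ξ := fun ξ hξ =>
      ih ξ hξ fun ζ hζ => h ζ (hζ.trans hξ.le)
    by_cases hs : SecondMoves γ
    · rw [play_of_secondMoves hs, play_of_secondMoves hs]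
      congr 1
      exact seqName_congr fun γ' h' _ => ih' γ' h'
    · rw [play_of_not_secondMoves hs, play_of_not_secondMoves hs, h γ le_rfl]
      congr 1
      unfold prevMove
      split_ifs with hlt
      · exact ih' _ hlt
      · rfl

theorem prevMove_congr {t' : Ordinal.{u} → Bool} (h : ∀ ξ < γ, t ξ = t' ξ) :
    prevMove Q σ p₀ x₀ M t γ = prevMove Q σ p₀ x₀ M t' γ := by
  unfold prevMove
  split_ifs with hlt
  · exact play_congr fun ξ hξ => h ξ (hξ.trans_lt hlt)
  · rfl

/-- The replies of the first player are legal. -/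
def IsLegalReply (Q : NotionName P) (p : P) (x₀ : PName P)
    (M : Ordinal.{u} → Bool → PName P → PName P) : Prop :=
  ∀ γ b x, Q.Mem x p → Q.Le x x₀ p → Q.Mem (M γ b x) p ∧ Q.Le (M γ b x) x p

/-- What the moves of a play satisfy. -/
structure IsGoodMove (Q : NotionName P) (σ : PName P) (p : P) (x₀ : PName P)
    (M : Ordinal.{u} → Bool → PName P → PName P) (t : Ordinal.{u} → Bool) (γ : Ordinal.{u}) :
    Prop where
  mem : Q.Mem (play Q σ p x₀ M t γ) p
  le_start : Q.Le (play Q σ p x₀ M t γ) x₀ p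
  le_play : ∀ γ' < γ, Q.Le (play Q σ p x₀ M t γ) (play Q σ p x₀ M t γ') p
  obeys : SecondMoves γ → ((seqName γ (fun γ' _ => play Q σ p x₀ M t γ')
    (fun _ _ => True)).opair (play Q σ p x₀ M t γ) ∊ σ) p

variable {β : Ordinal.{u}}

/-- By induction, the earlier moves form a position forced by `p₀` itself, so the maximum principle
gives an answer without strengthening `p₀`. This keeps the whole tree of plays in the ground model.
-/
theorem isGoodMove (hσ : isWinningStrategy Q β σ p₀) (hx₀ : Q.Mem x₀ p₀)
    (hM : IsLegalReply Q p₀ x₀ M) (hγ : γ ≤ β) : IsGoodMove Q σ p₀ x₀ M t γ := by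
  induction γ using WellFoundedLT.induction with
  | ind γ ih =>
    have ih' : ∀ ξ < γ, IsGoodMove Q σ p₀ x₀ M t ξ := fun ξ hξ => ih ξ hξ (hξ.le.trans hγ)
    by_cases hs : SecondMoves γ
    · have hpos : isPosition Q σ γ
          (seqName γ (fun γ' _ => play Q σ p₀ x₀ M t γ') (fun _ _ => True)) p₀ :=
        isPosition_seqName (fun _ _ q _ => ⟨q, le_rfl, trivial⟩)
          (fun _ _ _ _ _ _ _ _ _ _ => rfl)
          (fun ξ hξ _ _ r hr _ => (ih' ξ hξ).mem.mono hr)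
          (fun ξ hξ ζ hζ _ _ r _ _ hr _ _ => ((ih' ξ hξ).le_play ζ hζ).mono hr)
          (fun ξ hξ hsec _ _ r hr _ => mem_mono ((ih' ξ hξ).obeys hsec) hr)
      have hans := isAnswer_answer hσ hγ hs hpos
      rw [← play_of_secondMoves hs] at hans
      have hle : ∀ γ' < γ, Q.Le (play Q σ p₀ x₀ M t γ) (play Q σ p₀ x₀ M t γ') p₀ :=
        fun γ' h' => hans.2.2 (PName.ord P γ') _ p₀ le_rfl
          (opair_mem_seqName_of_ok (F := fun γ' _ => play Q σ p₀ x₀ M t γ')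
            (s := p₀) h' trivial le_rfl)
      have h0 : 0 < γ := pos_iff_ne_zero.2 (secondMoves_iff.1 hs).1
      exact ⟨hans.1, (hle 0 h0).trans hans.1 (ih' 0 h0).mem hx₀ (ih' 0 h0).le_start, hle,
        fun _ => hans.2.1⟩
    · obtain rfl | ⟨ξ, rfl⟩ := eq_zero_or_eq_succ hs
      · have h := hM 0 (t 0) x₀ hx₀ hx₀.le_refl
        have e : play Q σ p₀ x₀ M t 0 = M 0 (t 0) x₀ := by
          rw [play_of_not_secondMoves hs, prevMove_zero]
        rw [← e] at h
        exact ⟨h.1, h.2, fun γ' h' => absurd h' (not_lt.2 (zero_le)), fun h' => absurd h' hs⟩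
      · have hξ := ih' ξ (Order.lt_succ ξ)
        have h := hM (Order.succ ξ) (t (Order.succ ξ)) _ hξ.mem hξ.le_start
        have e : play Q σ p₀ x₀ M t (Order.succ ξ) =
            M (Order.succ ξ) (t (Order.succ ξ)) (play Q σ p₀ x₀ M t ξ) := by
          rw [play_of_not_secondMoves hs, prevMove_succ]
        rw [← e] at h
        refine ⟨h.1, h.2.trans h.1 hξ.mem hx₀ hξ.le_start, fun γ' h' => ?_,
          fun h' => absurd h' hs⟩
        obtain rfl | hlt := (Order.lt_succ_iff.1 h').eq_or_lt
        · exact h.2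
        · exact h.2.trans h.1 hξ.mem (ih' γ' h').mem (hξ.le_play γ' hlt)

/-- A name of a branch of length `δ`: if `ok γ s`, then `s` forces the branch to agree with `τ s` up
to and including `γ`. -/
structure IsBranch (p : P) (δ : Ordinal.{u}) (ok : Ordinal.{u} → P → Prop)
    (τ : P → Ordinal.{u} → Bool) : Prop where
  dense : ∀ γ < δ, ∀ q ≤ p, ∃ r ≤ q, ok γ r
  anti : ∀ γ γ' s, γ' ≤ γ → ok γ s → ok γ' s
  coh : ∀ γ s s' r, ok γ s → ok γ s' → r ≤ s → r ≤ s' → ∀ ξ ≤ γ, τ s ξ = τ s' ξ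

/-- Below a condition `s` that determines the branch up to `γ`, the named play agrees up to `γ` with
the play along `τ s`, which is good. So the named play is a position at `δ`, and the move that `σ`
makes there is the bound. -/
theorem IsBranch.exists_lower_bound (hσ : isWinningStrategy Q β σ p₀) (hx₀ : Q.Mem x₀ p₀)
    (hM : IsLegalReply Q p₀ x₀ M) {p : P} (hp : p ≤ p₀) {δ : Ordinal.{u}} (hδ : δ ≤ β)
    (hsec : SecondMoves δ) {ok : Ordinal.{u} → P → Prop} {τ : P → Ordinal.{u} → Bool}
    (hb : IsBranch p δ ok τ) :
    ∃ c : Iteration P Q, c.fst ≤ p ∧ Q.Le c.snd x₀ c.fst ∧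
      ∀ γ < δ, ∀ s, ok γ s → ∀ r ≤ c.fst, r ≤ s →
        Q.Le c.snd (play Q σ p₀ x₀ M (τ s) γ) r := by
  have good : ∀ t, ∀ γ < δ, IsGoodMove Q σ p₀ x₀ M t γ := fun t γ hγ =>
    isGoodMove hσ hx₀ hM (hγ.le.trans hδ)
  have hpos : isPosition Q σ δ (seqName δ (fun γ s => play Q σ p₀ x₀ M (τ s) γ) ok) p := by
    refine isPosition_seqName hb.dense ?_ ?_ ?_ ?_
    · exact fun γ _ s s' r hs hs' _ hrs hrs' => play_congr (hb.coh γ s s' r hs hs' hrs hrs')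
    · exact fun γ hγ s _ r hr _ => (good (τ s) γ hγ).mem.mono (hr.trans hp)
    · intro γ' hγ' γ hγ s s' r hs hs' hr hrs hrs'
      rw [play_congr (hb.coh γ s s' r hs (hb.anti γ' γ s' hγ.le hs') hrs hrs')]
      exact ((good (τ s') γ' hγ').le_play γ hγ).mono (hr.trans hp)
    · intro γ hγ hsec s hs r hr hrs
      refine mem_congr_left (opair_congr ?_ (eq_refl _ _))
        (mem_mono ((good (τ s) γ hγ).obeys hsec) (hr.trans hp))
      -- `σ` was applied to the name of the play along the fixed branch `τ s`; below `s` it denotes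
      -- the same sequence as the initial segment of the named play.
      refine seqName_eq_seqName (fun _ _ q _ => ⟨q, le_rfl, trivial⟩)
        (fun ξ hξ q hq => hb.dense ξ (hξ.trans hγ) q (hq.trans hr)) ?_
      intro ξ hξ _ s' r' _ hs' hr' _ hrs'
      exact play_congr (hb.coh ξ s s' r' (hb.anti γ ξ s hξ.le hs) hs' (hr'.trans hrs) hrs')
  obtain ⟨q, hq, y, hy⟩ := hσ.2 ⟨δ, hδ, hsec⟩ _ p hp hpos p le_rfl
  obtain ⟨c, hc, e⟩ := NotionName.Mem.exists_condition (Q := Q) hy.1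
  have hle : ∀ γ < δ, ∀ s, ok γ s → ∀ r ≤ c.fst, r ≤ s →
      Q.Le c.snd (play Q σ p₀ x₀ M (τ s) γ) r := fun γ hγ s hs r hr hrs =>
    NotionName.Le.congr (Q := Q) (eq_symm (eq_mono e hr)) (eq_refl _ _)
      (hy.2.2 (PName.ord P γ) _ r (hr.trans hc) (opair_mem_seqName_of_ok
        (F := fun γ s => play Q σ p₀ x₀ M (τ s) γ) hγ hs hrs))
  refine ⟨c, hc.trans hq, mem_local fun r hr => ?_, hle⟩
  -- The bound lies below `x₀` because it lies below the move at stage `0`.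
  have h0 : 0 < δ := pos_iff_ne_zero.2 (secondMoves_iff.1 hsec).1
  obtain ⟨s, hs, hok⟩ := hb.dense 0 h0 r (hr.trans (hc.trans hq))
  have hsp : s ≤ p₀ := hs.trans (hr.trans (hc.trans (hq.trans hp)))
  have hgood := good (τ s) 0 h0
  exact ⟨s, hs, (hle 0 h0 s hok s (hs.trans hr) le_rfl).trans
    (NotionName.Mem.mono (Q := Q) c.forces_mem (hs.trans hr)) (hgood.mem.mono hsp) (hx₀.mono hsp)
    (hgood.le_start.mono hsp)⟩

theorem prevMove_mem (hσ : isWinningStrategy Q β σ p₀) (hx₀ : Q.Mem x₀ p₀)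
    (hM : IsLegalReply Q p₀ x₀ M) (hγ : γ ≤ β) :
    Q.Mem (prevMove Q σ p₀ x₀ M t γ) p₀ ∧ Q.Le (prevMove Q σ p₀ x₀ M t γ) x₀ p₀ := by
  unfold prevMove
  split_ifs with hlt
  · have := isGoodMove (t := t) hσ hx₀ hM (hlt.le.trans hγ)
    exact ⟨this.mem, this.le_start⟩
  · exact ⟨hx₀, hx₀.le_refl⟩

end Game

/-! ### Deciding a fresh sequence below a fixed first coordinate -/

section Main

variable {P : Type u} [Preorder P] {Q : NotionName P}

/-- The name `z` is `y` below `r` and `x` at conditions incompatible with `r`. Thus a strengthening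
available only below `r` becomes a move that is legal at `p`. -/
theorem NotionName.Mem.exists_mix {x y : PName P} {p r : P} (hx : Q.Mem x p) (hr : r ≤ p)
    (hy : Q.Mem y r) (hyx : Q.Le y x r) : ∃ z, Q.Mem z p ∧ Q.Le z x p ∧ (z ≐ y) r := by
  have hφ : IsFormula fun z q => Q.Mem z q ∧ Q.Le z x q ∧ ∀ s ≤ q, s ≤ r → (z ≐ y) s :=
    { mono := fun h hq => ⟨h.1.mono hq, h.2.1.mono hq, fun s hs => h.2.2 s (hs.trans hq)⟩
      dense := fun h => ⟨mem_local fun q hq => (h q hq).imp fun _ h => ⟨h.1, h.2.1⟩,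
        mem_local fun q hq => (h q hq).imp fun _ h => ⟨h.1, h.2.2.1⟩,
        fun s hs hsr => eq_local fun q hq => (h q (hq.trans hs)).imp fun t h =>
          ⟨h.1, h.2.2.2 t le_rfl (h.1.trans (hq.trans hsr))⟩⟩
      congr := fun e h => ⟨h.1.congr e, h.2.1.congr e (eq_refl _ _), fun s hs hsr =>
        eq_trans (eq_symm (eq_mono e hs)) (h.2.2 s hs hsr)⟩ }
  obtain ⟨z, hz⟩ := hφ.exists_of_ex (p := p) fun q hq => by
    by_cases hc : Compat q r
    · obtain ⟨s, hsq, hsr⟩ := hc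
      exact ⟨s, hsq, y, hy.mono hsr, hyx.mono hsr, fun _ _ _ => eq_refl _ _⟩
    · exact ⟨q, le_rfl, x, hx.mono hq, (hx.mono hq).le_refl,
        fun s hs hsr => absurd ⟨s, hs, hsr⟩ hc⟩
  exact ⟨z, hz.1, hz.2.1, hz.2.2 r hr le_rfl⟩

variable {f : PName (Iteration P Q)} {θ : Ordinal.{u}} {c₀ : Iteration P Q}

/-- The pair `(p, x)` decides the first `α` values of `f` to be those of `a`. -/
def DecidesBelow (f : PName (Iteration P Q)) (p : P) (x : PName P) (α : Ordinal.{u})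
    (a : Ordinal.{u} → ZFSet.{u}) : Prop :=
  ∀ c : Iteration P Q, c.fst ≤ p → Q.Le c.snd x c.fst → ∀ γ < α, Decides f c γ (a γ)

/-- The pair `(p, x)` can be strengthened in the second coordinate to decide `f ↾ α`. -/
def CanDecide (f : PName (Iteration P Q)) (p : P) (x : PName P) (α : Ordinal.{u}) : Prop :=
  ∃ y, Q.Mem y p ∧ Q.Le y x p ∧ ∃ a, DecidesBelow f p y α a

/-- Some `f ↾ α` with `α < θ` cannot be decided by strengthening `(p, x)` in the second
coordinate. -/
def Fails (f : PName (Iteration P Q)) (θ : Ordinal.{u}) (p : P) (x : PName P) : Prop :=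
  ∃ α < θ, ¬ CanDecide f p x α

theorem Fails.of_le {p : P} {x y : PName P} (h : Fails f θ p x) (hx : Q.Mem x p) (hy : Q.Mem y p)
    (hyx : Q.Le y x p) : Fails f θ p y := by
  obtain ⟨α, hα, hno⟩ := h
  refine ⟨α, hα, fun ⟨z, hz, hzy, ha⟩ => hno ⟨z, hz, hzy.trans hz hy hx hyx, ha⟩⟩

/-- If every `p` failed at some `α p`, the supremum of these would be below `θ`. A condition `d ≤ c`
decides `f` that far, so `d.snd` would witness that `d.fst` does not fail. -/
theorem exists_not_fails (hf : isFreshSequence θ f c₀) (hθ : Cardinal.mk P < θ.cof)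
    {c : Iteration P Q} (hc : c ≤ c₀) : ∃ p ≤ c.fst, ¬ Fails f θ p c.snd := by
  by_contra! hcon
  have : ∀ p : {p : P // p ≤ c.fst}, ∃ α < θ, ¬ CanDecide f p c.snd α := fun p => hcon p p.2
  choose α hα hno using this
  have hsup : ⨆ p, α p < θ :=
    Ordinal.iSup_lt_of_lt_cof ((Cardinal.mk_subtype_le _).trans_lt hθ) hα
  obtain ⟨d, hd, a, ha⟩ := exists_decides_lt hf hc hsup
  refine hno ⟨d.fst, hd.1⟩ ⟨d.snd, d.forces_mem, hd.2, a, fun c' h₁ h₂ γ hγ => ?_⟩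
  exact (ha γ (hγ.trans_le (Ordinal.le_iSup α _))).mono ⟨h₁, h₂⟩

/-- Below `c` every strengthening of the second coordinate can be strengthened, without changing
the first coordinate, so as to decide any given proper initial segment of `f`. -/
def IsUniform (f : PName (Iteration P Q)) (θ : Ordinal.{u}) (c : Iteration P Q) : Prop :=
  ∀ x, Q.Mem x c.fst → Q.Le x c.snd c.fst → ∀ α < θ, CanDecide f c.fst x α

/-- Failure at `p` persists to stronger second coordinates. If the first player creates it whenever
possible, a bound of the play that does not fail at `p` has no strengthening that fails at `p`. -/
theorem exists_isUniform {σ : PName P} {β κ : Ordinal.{u}} {e : Ordinal.{u} → P}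
    (hf : isFreshSequence θ f c₀) (hσ : isWinningStrategy Q β σ c₀.fst)
    (hθ : Cardinal.mk P < θ.cof) (hκ : κ ≤ β) (hsec : SecondMoves κ)
    (he : ∀ p, ∃ γ < κ, ¬ SecondMoves γ ∧ e γ = p) : ∃ c ≤ c₀, IsUniform f θ c := by
  have hstep : ∀ p x, Q.Mem x c₀.fst → ∃ y, Q.Mem y c₀.fst ∧ Q.Le y x c₀.fst ∧
      (p ≤ c₀.fst → (∃ z, Q.Mem z p ∧ Q.Le z x p ∧ Fails f θ p z) → Fails f θ p y) := by
    intro p x hx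
    by_cases h : p ≤ c₀.fst ∧ ∃ z, Q.Mem z p ∧ Q.Le z x p ∧ Fails f θ p z
    · obtain ⟨hp, z, hz, hzx, hfail⟩ := h
      obtain ⟨y, hy, hyx, e⟩ := hx.exists_mix hp hz hzx
      exact ⟨y, hy, hyx, fun _ _ => hfail.of_le hz (hy.mono hp)
        (hz.le_refl.congr (eq_symm e) (eq_refl _ _))⟩
    · exact ⟨x, hx, hx.le_refl, fun h₁ h₂ => absurd ⟨h₁, h₂⟩ h⟩
  have : Nonempty (PName P) := ⟨c₀.snd⟩
  choose! y hy hyx hfail using hstep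
  let M : Ordinal.{u} → Bool → PName P → PName P := fun γ _ x => y (e γ) x
  have hM : IsLegalReply Q c₀.fst c₀.snd M := fun γ _ x hx _ => ⟨hy _ x hx, hyx _ x hx⟩
  have hc₀ : Q.Mem c₀.snd c₀.fst := c₀.forces_mem
  -- The replies ignore the bit, so any branch of the ground model will do.
  have hb : IsBranch c₀.fst κ (fun _ _ => True) (fun _ _ => false) :=
    ⟨fun _ _ q _ => ⟨q, le_rfl, trivial⟩, fun _ _ _ _ _ => trivial,
      fun _ _ _ _ _ _ _ _ _ _ => rfl⟩
  obtain ⟨c, hc, hcle, hlow⟩ := hb.exists_lower_bound hσ hc₀ hM le_rfl hκ hsec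
  obtain ⟨p, hp, hgood⟩ := exists_not_fails (c := c) hf hθ ⟨hc, hcle⟩
  have hp₀ := hp.trans hc
  have hcp : Q.Mem c.snd p := mem_mono c.forces_mem hp
  refine ⟨⟨p, c.idx, hcp⟩, ⟨hp₀, hcle.mono hp⟩, fun x hx hxc => ?_⟩
  suffices h : ¬ Fails f θ p x by
    intro α hα
    by_contra hno
    exact h ⟨α, hα, hno⟩
  intro hxfail
  -- At the stage handling `p`, the failing `x` lies below the previous move `w`, so the reply to
  -- `w` was chosen to fail at `p`; then `c.snd`, which lies below this reply, fails too.
  obtain ⟨γ, hγ, hfirst, hγp⟩ := he p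
  let w := prevMove Q σ c₀.fst c₀.snd M (fun _ => false) γ
  have hw : Q.Mem w c₀.fst := (prevMove_mem hσ hc₀ hM (hγ.le.trans hκ)).1
  have hplay : play Q σ c₀.fst c₀.snd M (fun _ => false) γ = y p w := by
    rw [play_of_not_secondMoves hfirst, ← hγp]
  have hle := hlow γ hγ p trivial p hp le_rfl
  rw [hplay] at hle
  have hyp := (hy p w hw).mono hp₀
  have hwp := hw.mono hp₀
  have hxw : Q.Le x w p := NotionName.Le.trans hx hcp hwp hxc
    (hle.trans hcp hyp hwp ((hyx p w hw).mono hp₀))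
  exact hgood ((hfail p w hw hp₀ ⟨x, hx, hxw, hxfail⟩).of_le hyp hcp hle)

/-- Without a split, each value of `f` has only one candidate decided by strengthening `x` at
`c.fst`. These candidates form a sequence in the ground model that a condition below `c` forces to
be `f`. -/
theorem IsUniform.exists_split {c : Iteration P Q} (hc : IsUniform f θ c)
    (hf : isFreshSequence θ f c₀) (hθ : Order.IsSuccLimit θ) (hcc₀ : c ≤ c₀) (x : PName P)
    (hx : Q.Mem x c.fst) (hxc : Q.Le x c.snd c.fst) :
    ∃ ξ < θ, ∃ v : Bool → ZFSet.{u}, v false ≠ v true ∧ ∃ y : Bool → PName P, ∀ b,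
      Q.Mem (y b) c.fst ∧ Q.Le (y b) x c.fst ∧
      ∀ d : Iteration P Q, d.fst ≤ c.fst → Q.Le d.snd (y b) d.fst → Decides f d ξ (v b) := by
  by_contra hcon
  have huniq : ∀ ξ < θ, ∀ y y' w w', (Q.Mem y c.fst ∧ Q.Le y x c.fst ∧
      ∀ d : Iteration P Q, d.fst ≤ c.fst → Q.Le d.snd y d.fst → Decides f d ξ w) →
      (Q.Mem y' c.fst ∧ Q.Le y' x c.fst ∧
      ∀ d : Iteration P Q, d.fst ≤ c.fst → Q.Le d.snd y' d.fst → Decides f d ξ w') → w = w' := by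
    intro ξ hξ y y' w w' h h'
    by_contra hne
    refine hcon ⟨ξ, hξ, fun b => cond b w' w, hne, fun b => cond b y' y, fun b => ?_⟩
    cases b
    · exact h
    · exact h'
  have hval : ∀ γ < θ, ∃ v y, Q.Mem y c.fst ∧ Q.Le y x c.fst ∧
      ∀ d : Iteration P Q, d.fst ≤ c.fst → Q.Le d.snd y d.fst → Decides f d γ v := by
    intro γ hγ
    obtain ⟨y, hy, hyx, a, ha⟩ := hc x hx hxc _ (hθ.succ_lt hγ)
    exact ⟨a γ, y, hy, hyx, fun d h₁ h₂ => ha d h₁ h₂ γ (Order.lt_succ γ)⟩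
  have : Nonempty (PName P) := ⟨x⟩
  choose! v y hy using hval
  obtain ⟨d, hd, ed⟩ := hx.exists_condition
  have hdc : d ≤ c := ⟨hd, (hxc.mono hd).congr (eq_symm ed) (eq_refl _ _)⟩
  refine not_forall_decides hf (hdc.trans hcc₀) v fun γ hγ => Decides.of_dense fun d₁ hd₁ => ?_
  obtain ⟨d₂, hd₂, a, ha⟩ := exists_decides_lt hf (hd₁.trans (hdc.trans hcc₀)) (hθ.succ_lt hγ)
  refine ⟨d₂, hd₂, ?_⟩
  have hd₂d := hd₂.trans hd₁
  have hd₂c : d₂.fst ≤ c.fst := hd₂d.1.trans hd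
  have hd₂x : Q.Le d₂.snd x d₂.fst :=
    NotionName.Le.congr (Q := Q) (eq_refl _ _) (eq_mono ed hd₂d.1) hd₂d.2
  -- The value decided by `d₂` is compared with the unique candidate: mixing makes `d₂.snd` a
  -- strengthening of `x` at `c.fst`, uniformity then decides a value below it, and `d₃` sees both
  -- decisions.
  obtain ⟨z, hz, hzx, ez⟩ := hx.exists_mix hd₂c d₂.forces_mem hd₂x
  obtain ⟨y', hy', hy'z, a', ha'⟩ := hc z hz (hzx.trans hz hx c.forces_mem hxc) _ (hθ.succ_lt hγ)
  have e₁ : a' γ = v γ := huniq γ hγ y' (y γ) _ _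
    ⟨hy', hy'z.trans hy' hz hx hzx, fun d h₁ h₂ => ha' d h₁ h₂ γ (Order.lt_succ γ)⟩ (hy γ hγ)
  obtain ⟨d₃, hd₃, e₃⟩ := (hy'.mono hd₂c).exists_condition
  have hd₃d₂ : d₃ ≤ d₂ := ⟨hd₃, (hy'z.mono (hd₃.trans hd₂c)).congr (eq_symm e₃) (eq_mono ez hd₃)⟩
  have e₂ : a γ = a' γ := Decides.unique hf.1.2.2 (hd₃d₂.trans (hd₂d.trans (hdc.trans hcc₀)))
    ((ha γ (Order.lt_succ γ)).mono hd₃d₂) (ha' d₃ (hd₃.trans hd₂c)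
      ((hy'.mono (hd₃.trans hd₂c)).le_refl.congr (eq_symm e₃) (eq_refl _ _)) γ (Order.lt_succ γ))
  rw [← e₁, ← e₂]
  exact ha γ (Order.lt_succ γ)

/-! ### The generic branch -/

/-- `r` decides whether `e γ` is in the generic filter: `b` is the truth value. -/
def ForcesBit (e : Ordinal.{u} → P) (r : P) (γ : Ordinal.{u}) : Bool → Prop
  | true => ∀ s ≤ r, Compat s (e γ)
  | false => ¬ Compat r (e γ)

variable {e : Ordinal.{u} → P}

theorem ForcesBit.mono {r s : P} {γ : Ordinal.{u}} {b : Bool} (h : ForcesBit e r γ b)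
    (hs : s ≤ r) : ForcesBit e s γ b := by
  cases b
  · exact fun ⟨t, h₁, h₂⟩ => h ⟨t, h₁.trans hs, h₂⟩
  · exact fun t ht => h t (ht.trans hs)

theorem ForcesBit.unique {r : P} {γ : Ordinal.{u}} {b b' : Bool} (h : ForcesBit e r γ b)
    (h' : ForcesBit e r γ b') : b = b' := by
  cases b <;> cases b'
  · rfl
  · exact absurd (h' r le_rfl) h
  · exact absurd (h r le_rfl) h'
  · rfl

theorem exists_forcesBit (e : Ordinal.{u} → P) (γ : Ordinal.{u}) (q : P) :
    ∃ r ≤ q, ∃ b, ForcesBit e r γ b := by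
  by_cases h : Compat q (e γ)
  · obtain ⟨r, hr, hr'⟩ := h
    exact ⟨r, hr, true, fun s hs => ⟨s, le_rfl, hs.trans hr'⟩⟩
  · exact ⟨q, le_rfl, false, h⟩

open Classical in
/-- The bits decided by a condition. -/
noncomputable def bits (e : Ordinal.{u} → P) (r : P) (γ : Ordinal.{u}) : Bool :=
  decide (ForcesBit e r γ true)

theorem ForcesBit.bits_eq {r : P} {γ : Ordinal.{u}} {b : Bool} (h : ForcesBit e r γ b) :
    bits e r γ = b := by
  classical
  unfold bits
  cases b
  · exact decide_eq_false fun h' => Bool.noConfusion (h.unique h')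
  · exact decide_eq_true h

/-- A nontrivial notion of forcing adds a sequence of bits all of whose proper initial segments are
decided densely often, although the sequence itself is not decided. -/
theorem exists_isBranch_bits (hP : IsNontrivial P) {κ : Ordinal.{u}} {p₀ : P}
    (he : ∀ p ≤ p₀, ∃ γ < κ, e γ = p) : ∃ δ ≤ κ, Order.IsSuccLimit δ ∧ ∃ p ≤ p₀,
      IsBranch p δ (fun γ s => ∀ ξ ≤ γ, ∃ b, ForcesBit e s ξ b) (bits e) ∧
      ∀ r ≤ p, ¬ ∀ γ < δ, ∃ b, ForcesBit e r γ b := by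
  let S : Set Ordinal.{u} := {δ | ∃ p ≤ p₀, ∀ r ≤ p, ¬ ∀ γ < δ, ∃ b, ForcesBit e r γ b}
  have hκ : κ ∈ S := by
    refine ⟨p₀, le_rfl, fun r hr hdec => ?_⟩
    -- If `r` decided every bit, it would decide the bit of `q`: "false" contradicts `q ≤ r`, and
    -- "true" makes `q'` compatible with `q`.
    obtain ⟨q, hq, q', hq', hinc⟩ := hP r
    obtain ⟨γ, hγ, rfl⟩ := he q (hq.trans hr)
    obtain ⟨b, hb⟩ := hdec γ hγ
    cases b
    · exact hb ⟨e γ, hq, le_rfl⟩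
    · obtain ⟨s, hs, hs'⟩ := hb q' hq'
      exact hinc ⟨s, hs', hs⟩
  obtain ⟨δ, ⟨p, hp, hδ⟩, hmin⟩ := wellFounded_lt.has_min S ⟨κ, hκ⟩
  have hbelow : ∀ γ < δ, ∀ q ≤ p, ∃ r ≤ q, ∀ ξ ≤ γ, ∃ b, ForcesBit e r ξ b := by
    intro γ hγ q hq
    have hγS : ¬ ∃ p ≤ p₀, ∀ r ≤ p, ¬ ∀ ξ < γ, ∃ b, ForcesBit e r ξ b := fun h => hmin γ h hγ
    push Not at hγS
    obtain ⟨r, hr, hdec⟩ := hγS q (hq.trans hp)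
    obtain ⟨s, hs, hb⟩ := exists_forcesBit e γ r
    refine ⟨s, hs.trans hr, fun ξ hξ => ?_⟩
    obtain rfl | hlt := hξ.eq_or_lt
    · exact hb
    · exact (hdec ξ hlt).imp fun b h => h.mono hs
  refine ⟨δ, not_lt.1 (hmin κ hκ), ?_, p, hp, ⟨hbelow, ?_, ?_⟩, hδ⟩
  · obtain rfl | ⟨ξ, rfl⟩ | h := Ordinal.zero_or_succ_or_isSuccLimit δ
    · exact absurd (fun γ hγ => absurd hγ (not_lt.2 zero_le)) (hδ p le_rfl)
    · obtain ⟨r, hr, h⟩ := hbelow ξ (Order.lt_succ ξ) p le_rfl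
      exact absurd (fun γ hγ => h γ (Order.lt_succ_iff.1 hγ)) (hδ r hr)
    · exact h
  · exact fun γ γ' s h hs ξ hξ => hs ξ (hξ.trans h)
  · intro γ s s' r hs hs' hrs hrs' ξ hξ
    obtain ⟨b, hb⟩ := hs ξ hξ
    obtain ⟨b', hb'⟩ := hs' ξ hξ
    rw [hb.bits_eq, hb'.bits_eq]
    exact (hb.mono hrs).unique (hb'.mono hrs')

/-! ### Enumerating a notion of forcing along the first player's stages -/

theorem aleph0_le_of_isNontrivial (hP : IsNontrivial P) [Nonempty P] :
    Cardinal.aleph0 ≤ Cardinal.mk P := by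
  rw [← Cardinal.infinite_iff]
  by_contra hfin
  rw [not_infinite_iff_finite] at hfin
  obtain ⟨m, hm⟩ := Set.finite_univ.exists_minimal (α := P) Set.univ_nonempty
  obtain ⟨q, hq, r, hr, hno⟩ := hP m
  exact hno ⟨m, hm.2 trivial hq, hm.2 trivial hr⟩

/-- A notion of forcing is enumerated along the stages of the first player. -/
theorem exists_enumeration {P : Type u} [Nonempty P] (hP : Cardinal.aleph0 ≤ Cardinal.mk P) :
    ∃ e : Ordinal.{u} → P, ∀ p, ∃ γ < (Cardinal.mk P).ord, ¬ SecondMoves γ ∧ e γ = p := by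
  set κ := (Cardinal.mk P).ord with hκ
  have hlim : Order.IsSuccLimit κ := Cardinal.isSuccLimit_ord hP
  let T := {i : κ.ToType // ¬ SecondMoves (Ordinal.ToType.mk.symm i).1}
  have hle : Cardinal.mk P ≤ Cardinal.mk T := by
    have hinj : Cardinal.mk κ.ToType ≤ Cardinal.mk (T × Bool) := by
      classical
      -- A stage of the second player is coded by its successor, which belongs to the first player;
      -- the tag separates the two cases. Hence the first player has `|P|` many stages.
      let g : κ.ToType → T × Bool := fun i =>
        if h : SecondMoves (Ordinal.ToType.mk.symm i).1 then
          (⟨Ordinal.ToType.mk ⟨Order.succ (Ordinal.ToType.mk.symm i).1,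
            hlim.succ_lt (Set.mem_Iio.1 (Ordinal.ToType.mk.symm i).2)⟩, by
            rw [OrderIso.symm_apply_apply, secondMoves_succ]
            exact not_not.2 h⟩, false)
        else (⟨i, h⟩, true)
      refine Cardinal.mk_le_of_injective (f := g) fun i j hij => ?_
      by_cases hi : SecondMoves (Ordinal.ToType.mk.symm i).1 <;>
        by_cases hj : SecondMoves (Ordinal.ToType.mk.symm j).1
      · have h : (Ordinal.ToType.mk.symm i).1 = (Ordinal.ToType.mk.symm j).1 := by
          simpa [g, hi, hj] using congrArg (fun k => (Ordinal.ToType.mk.symm k.1.1).1) hij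
        exact Ordinal.ToType.mk.symm.injective (Subtype.ext h)
      · simp [g, hi, hj] at hij
      · simp [g, hi, hj] at hij
      · simpa [g, hi, hj] using congrArg (fun k => k.1.1) hij
    rw [Cardinal.mk_toType, hκ, Cardinal.card_ord, Cardinal.mk_prod, Cardinal.lift_uzero] at hinj
    by_contra! hlt
    refine absurd hinj (not_le.2 (Cardinal.mul_lt_of_lt hP hlt ?_))
    simpa using (Cardinal.natCast_lt_aleph0 (n := 2)).trans_le hP
  obtain ⟨g⟩ := hle
  let G : P → Ordinal.{u} := fun p => (Ordinal.ToType.mk.symm (g p).1).1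
  have hG : Function.Injective G := fun p q h => g.injective
    (Subtype.ext (Ordinal.ToType.mk.symm.injective (Subtype.ext h)))
  exact ⟨Function.invFun G, fun p => ⟨G p, (Ordinal.ToType.mk.symm (g p).1).2, (g p).2,
    Function.leftInverse_invFun hG p⟩⟩

/-! ### Recovering the generic branch from the fresh sequence -/

/-- At each splitting point of the tree, the value of `f` reveals which way the branch went. An
initial segment of `f` in the ground model that covers all these points therefore determines every
bit, although no condition below `p` does. -/
theorem not_isUniform {σ : PName P} {β κ : Ordinal.{u}} {c : Iteration P Q}
    (hP : IsNontrivial P) (hcard : Cardinal.mk P ≤ β.card) (hβ : Cardinal.aleph0 ≤ β.card)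
    (hθ : β.card < θ.cof) (hf : isFreshSequence θ f c₀) (hcc₀ : c ≤ c₀)
    (hσ : isWinningStrategy Q β σ c.fst) (hκ : κ ≤ β)
    (he : ∀ p, ∃ γ < κ, ¬ SecondMoves γ ∧ e γ = p) : ¬ IsUniform f θ c := by
  classical
  intro hc
  have hlim : Order.IsSuccLimit θ := Ordinal.one_lt_cof_iff.1
    (Cardinal.one_lt_aleph0.trans (hβ.trans_lt hθ))
  have : Nonempty (PName P) := ⟨c.snd⟩
  choose! ξ hξ v hv y hy using hc.exists_split hf hlim hcc₀
  let M : Ordinal.{u} → Bool → PName P → PName P := fun _ b x => y x b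
  have hM : IsLegalReply Q c.fst c.snd M := fun _ b x hx hxc =>
    ⟨(hy x hx hxc b).1, (hy x hx hxc b).2.1⟩
  have hc' : Q.Mem c.snd c.fst := c.forces_mem
  -- Bits matter only at the first player's stages; elsewhere `c.fst` makes the bit trivially true
  -- below `c.fst`.
  let e' : Ordinal.{u} → P := fun γ => if SecondMoves γ then c.fst else e γ
  obtain ⟨δ, hδκ, hδ, p, hp, hb, hnot⟩ := exists_isBranch_bits (e := e') (κ := κ) (p₀ := c.fst) hP
    fun p _ => (he p).imp fun γ h => ⟨h.1, (if_neg h.2.1).trans h.2.2⟩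
  have hδβ := hδκ.trans hκ
  obtain ⟨d, hd, hdle, hlow⟩ :=
    hb.exists_lower_bound hσ hc' hM hp hδβ (secondMoves_of_isSuccLimit hδ)
  have hdc : d ≤ c := ⟨hd.trans hp, hdle⟩
  let prev : P → Ordinal.{u} → PName P := fun s γ => prevMove Q σ c.fst c.snd M (bits e' s) γ
  have hprev : ∀ s, ∀ γ < δ, Q.Mem (prev s γ) c.fst ∧ Q.Le (prev s γ) c.snd c.fst :=
    fun s γ hγ => prevMove_mem hσ hc' hM (hγ.le.trans hδβ)
  -- The branch is only named, so the splitting points along the bits decided by every `s` are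
  -- bounded; there are at most `|P| · |δ| ≤ |β|` of them, as `|β|` is infinite.
  have hsup : ⨆ k : P × δ.ToType, ξ (prev k.1 (Ordinal.ToType.mk.symm k.2).1) < θ := by
    refine Ordinal.iSup_lt_of_lt_cof (lt_of_le_of_lt ?_ hθ) fun k => ?_
    · rw [Cardinal.mk_prod, Cardinal.lift_id, Cardinal.lift_id, Cardinal.mk_toType]
      exact (mul_le_mul' hcard (Ordinal.card_le_card hδβ)).trans (Cardinal.mul_eq_self hβ).le
    · have := hprev k.1 _ (Set.mem_Iio.1 (Ordinal.ToType.mk.symm k.2).2)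
      exact hξ _ this.1 this.2
  obtain ⟨d', hd', a, ha⟩ := exists_decides_lt hf (hdc.trans hcc₀) (hlim.succ_lt hsup)
  have hd'p : d'.fst ≤ p := hd'.1.trans hd
  refine hnot d'.fst hd'p fun γ => ?_
  induction γ using WellFoundedLT.induction with
  | ind γ ih =>
    intro hγ
    by_cases hs : SecondMoves γ
    · refine ⟨true, fun s hsd => ⟨s, le_rfl, ?_⟩⟩
      rw [show e' γ = c.fst from if_pos hs]
      exact hsd.trans (hd'p.trans hp)
    by_contra! hcon
    -- If `d'.fst` leaves the bit at `γ` open, both values are forced by extensions. By induction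
    -- these agree on earlier bits, so they reach the same splitting point and force different
    -- values of `f` there, yet `d'` has decided that value.
    have hbit : ∀ b, ∃ s ≤ d'.fst, ForcesBit e' s γ b := by
      intro b
      cases b
      · have : ¬ ∀ s ≤ d'.fst, Compat s (e' γ) := hcon true
        push Not at this
        exact this
      · have : ¬ ¬ Compat d'.fst (e' γ) := hcon false
        obtain ⟨s, h₁, h₂⟩ := not_not.1 this
        exact ⟨s, h₁, fun t ht => ⟨t, le_rfl, ht.trans h₂⟩⟩
    choose s hsd hsb using hbit
    have hok : ∀ b, ∀ ζ ≤ γ, ∃ b', ForcesBit e' (s b) ζ b' := by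
      intro b ζ hζ
      obtain rfl | hlt := hζ.eq_or_lt
      · exact ⟨b, hsb b⟩
      · exact (ih ζ hlt (hlt.trans hγ)).imp fun b' h => h.mono (hsd b)
    have hsame : prev (s false) γ = prev (s true) γ := by
      refine prevMove_congr fun ζ hζ => ?_
      obtain ⟨b, hb⟩ := ih ζ hζ (hζ.trans hγ)
      rw [(hb.mono (hsd false)).bits_eq, (hb.mono (hsd true)).bits_eq]
    have hval : ∀ b, v (prev (s b) γ) b = a (ξ (prev (s b) γ)) := by
      intro b
      have hsbd : s b ≤ d.fst := (hsd b).trans hd'.1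
      have hsbc : s b ≤ c.fst := hsbd.trans (hd.trans hp)
      have hx := hprev (s b) γ hγ
      let d'' : Iteration P Q := ⟨s b, d'.idx, mem_mono d'.forces_mem (hsd b)⟩
      have hd'' : d'' ≤ d' := ⟨hsd b, NotionName.Le.mono (Q := Q)
        (NotionName.Mem.le_refl (Q := Q) d'.forces_mem) (hsd b)⟩
      have hle := hlow γ hγ (s b) (hok b) (s b) hsbd le_rfl
      rw [play_of_not_secondMoves hs, (hsb b).bits_eq] at hle
      have hyb := hy _ hx.1 hx.2 b
      have hdle' : Q.Le d'.snd (y (prev (s b) γ) b) (s b) :=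
        NotionName.Le.trans (mem_mono d'.forces_mem (hsd b)) (mem_mono d.forces_mem hsbd)
          (hyb.1.mono hsbc) (NotionName.Le.mono (Q := Q) hd'.2 (hsd b)) hle
      refine Decides.unique hf.1.2.2 (hd''.trans (hd'.trans (hdc.trans hcc₀)))
        (hyb.2.2 d'' hsbc hdle') ((ha _ (Order.lt_succ_iff.2 ?_)).mono hd'')
      have := Ordinal.le_iSup (fun k : P × δ.ToType =>
        ξ (prev k.1 (Ordinal.ToType.mk.symm k.2).1)) (s b, Ordinal.ToType.mk ⟨γ, hγ⟩)
      simpa using this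
    have hx := hprev (s false) γ hγ
    refine hv _ hx.1 hx.2 ?_
    rw [hval false, hsame, hval true]

theorem isFreshSequence.mono {R : Type u} [Preorder R] {f : PName R} {c d : R}
    (h : isFreshSequence θ f c) (hd : d ≤ c) : isFreshSequence θ f d :=
  ⟨⟨fun z q hq => h.1.1 z q (hq.trans hd), fun x q hq => h.1.2.1 x q (hq.trans hd),
    fun x y z q hq => h.1.2.2 x y z q (hq.trans hd)⟩, fun q hq => h.2.1 q (hq.trans hd),
    fun α q hq => h.2.2 α q (hq.trans hd)⟩

theorem isWinningStrategy.mono {σ : PName P} {β : Ordinal.{u}} {p q : P}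
    (h : isWinningStrategy Q β σ p) (hq : q ≤ p) : isWinningStrategy Q β σ q :=
  ⟨fun x y z r hr => h.1 x y z r (hr.trans hq), fun α s r hr => h.2 α s r (hr.trans hq)⟩

end Main

end Forcing

/-- If `P` is nontrivial, `|P| ≤ β`, `⊩ Q̇` is `≤β`-strategically closed and `cof θ > β`, then
`P * Q̇` adds no fresh `θ`-sequences. -/
theorem mainTheorem2 (P : Type u) [Preorder P] (Q : Forcing.NotionName P) (β θ : Ordinal.{u})
    (hP : Forcing.IsNontrivial P) (hcard : Cardinal.mk P ≤ β.card)
    (hQ : Forcing.ForcedStrategicallyClosed Q β) (hθ : β.card < θ.cof) :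
    Forcing.AddsNoFreshSequence (Forcing.Iteration P Q) θ := by
  intro _ c₁ _ hex
  obtain ⟨c₂, -, f, hf⟩ := hex c₁ le_rfl
  -- Only the first coordinate is strengthened to fix the name of a strategy.
  obtain ⟨p, hp, σ, hσ⟩ := hQ c₂.fst c₂.fst le_rfl
  have : Nonempty P := ⟨p⟩
  have hinf := Forcing.aleph0_le_of_isNontrivial hP
  obtain ⟨e, he⟩ := Forcing.exists_enumeration hinf
  have hκ : (Cardinal.mk P).ord ≤ β := Cardinal.ord_le.2 hcard
  have hmem : Q.Mem c₂.snd c₂.fst := c₂.forces_mem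
  let c₀ : Forcing.Iteration P Q := ⟨p, c₂.idx, hmem.mono hp⟩
  have hf₀ := hf.mono (d := c₀) ⟨hp, (hmem.mono hp).le_refl⟩
  obtain ⟨c, hc, hu⟩ := Forcing.exists_isUniform hf₀ hσ (hcard.trans_lt hθ) hκ
    (Forcing.secondMoves_of_isSuccLimit (Cardinal.isSuccLimit_ord hinf)) he
  exact Forcing.not_isUniform hP hcard (hinf.trans hcard) hθ hf₀ hc (hσ.mono hc.1) hκ he hu
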